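/- **Theorem (Separator Upper Bound).** Consider a bandit with $n$ arms and contexts in $[k]$. Pulling arm $i$ produces a context $Z$ with $\Pr(Z=j\mid X=i)=A_{j,i}$, where $A\in\mathbb{R}^{k\times n}$ is known, has strictly positive entries, and has columns $A_1,\dots,A_n$ that are probability vectors; given $Z=j$ the reward is $\mathcal N(\mu_j,1)$, independently of the arm. For $\mu\in\mathbb{R}^k$ write $\mu\in\mathcal I(A)$ if $i\mapsto A_i^\top\mu$ has a unique maximizer, denoted $i^*(\mu)$; put $\Delta_i=A_{i^*(\mu)}^\top\mu-A_i^\top\mu$ and $\mathrm{Alt}(\mu,A)=\{\mu'\in\mathcal I(A): i^*(\mu')\ne i^*(\mu)\}$. For $w_z$ in $\mathrm{conv}(A)$, the convex hull of $A_1,\dots,A_n$, let $$F(w_z,\mu)=\min_{i\ne i^*(\mu)}\frac{\Delta_i^2}{2\sum_{j\in[k]}\frac{(A_{j,i^*(\mu)}-A_{j,i})^2}{w_{z,j}}},\qquad T^*(\mu,A)^{-1}=\sup_{w\in\Delta^{n-1}}F(Aw,\mu).$$ Let $N^Z_j(t)$ be the number of observations of context $j$ in the first $t$ rounds and $\hat\mu_j(t)$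 the average of the rewards observed with context $j$. The Separator Track and Stop (STS) algorithm operates as follows. * *Initialization.* Pull arms (in any way) until each context has been observed at least once. * *Stopping rule.* Let $\Lambda(t)=\inf_{\mu'\in\mathrm{Alt}(\hat\mu(t),A)}\sum_j N^Z_j(t)\frac{(\hat\mu_j(t)-\mu'_j)^2}{2}$ if $\hat\mu(t)\in\mathcal I(A)$ and $\Lambda(t)=0$ otherwise. Stop at $\tau_\delta$, the first time $t$, from the end of the initialization on, at which $\Lambda(t)>c_t(\delta)$, where $$c_t(\delta)=2\sum_{j\in[k]}\ln\bigl(4+\ln N^Z_j(t)\bigr)+k\,C^g\!\left(\frac{\ln(1/\delta)}{k}\right),\qquad C^g(x)=\min_{\lambda\in(1/2,1]}\frac{g(\lambda)+x}{\lambda},$$ $g(\lambda)=2\lambda-2\lambda\ln(4\lambda)+\ln\zeta(2\lambda)-\tfrac12\ln(1-\lambda)$, with $\zeta$ the Riemann zeta function (so $g(1)=+\infty$). * *G-tracking sampling rule.* After initialization, if $\hat\mu(t)\in\mathcal I(A)$, choose any maximizer $w^*(t)$ of $F(\cdot,\hat\mu(t))$ over $\mathrm{conv}(A)$, and let the policy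 $p(t+1)$ be the last point in $\mathrm{conv}(A)$ of the ray from $N^Z(t)/t$ through $w^*(t)$. Draw the next arm from any distribution $\pi\in\Delta^{n-1}$ with $A\pi=p(t+1)$. (If $\hat\mu(t)\notin\mathcal I(A)$ or $N^Z(t)/t=w^*(t)$, the next arm may be drawn from any distribution. All choices are measurable functions of the past observations and do not depend on $\delta$.) Then, for every such $A$ and every $\mu\in\mathcal I(A)$, $$\limsup_{\delta\to0}\frac{\mathbb E_{\mu,A}[\tau_\delta]}{\ln(1/\delta)}\le T^*(\mu,A).$$ -/

import Mathlib

open MeasureTheory ProbabilityTheory Filter Topology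
open scoped ENNReal Matrix

/-! Best arm identification with a separator post-action context: `n` arms, `k` context values,
context probability matrix `A` with `A j i = P(Z = j | X = i)`, and reward means `μ j` such that
`Y | Z = j` is Gaussian with mean `μ j` and variance `1`. -/

namespace SeparatorBandit

variable {n k : ℕ}

/-- `A` is a context probability matrix satisfying positivity: all entries are positive and every
column is a probability vector. -/
structure IsContextMatrix (A : Matrix (Fin k) (Fin n) ℝ) : Prop where
  pos : ∀ j i, 0 < A j i
  sum_eq_one : ∀ i, ∑ j, A j i = 1

/-- The expected reward `A_iᵀ μ` of arm `i`. -/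
def armMean (A : Matrix (Fin k) (Fin n) ℝ) (μ : Fin k → ℝ) (i : Fin n) : ℝ :=
  ∑ j, A j i * μ j

/-- `b` is the unique best arm, `b = i^*(μ, A)`. -/
def IsBestArm (A : Matrix (Fin k) (Fin n) ℝ) (μ : Fin k → ℝ) (b : Fin n) : Prop :=
  ∀ i, i ≠ b → armMean A μ i < armMean A μ b

/-- `I(A)`: the mean vectors for which the best arm is unique. -/
def uniqueBest (A : Matrix (Fin k) (Fin n) ℝ) : Set (Fin k → ℝ) :=
  {μ | ∃ b, IsBestArm A μ b}

/-- `Alt(μ, A)`: the mean vectors in `I(A)` whose best arm differs from that of `μ ∈ I(A)`. -/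
def alternatives (A : Matrix (Fin k) (Fin n) ℝ) (μ : Fin k → ℝ) : Set (Fin k → ℝ) :=
  {μ' | μ' ∈ uniqueBest A ∧ ∀ b, IsBestArm A μ b → ¬ IsBestArm A μ' b}

/-- The policy space: the convex hull of the columns `A_1, …, A_n` of `A`. -/
def policySpace (A : Matrix (Fin k) (Fin n) ℝ) : Set (Fin k → ℝ) :=
  convexHull ℝ (Set.range fun i : Fin n => fun j : Fin k => A j i)

/-- For `μ ∈ I(A)` with best arm `b` and context frequencies `w`,
`min_{i ≠ b} Δ_i² / (2 ∑_j (A_{j,b} - A_{j,i})² / w_j)`, where `Δ_i = A_bᵀ μ - A_iᵀ μ`.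
The outer infimum merely introduces the (unique) best arm `b`; the minimum over the empty set of
competitors (a single arm) is `∞`. -/
noncomputable def objective (A : Matrix (Fin k) (Fin n) ℝ) (μ w : Fin k → ℝ) : ℝ≥0∞ :=
  ⨅ (b : Fin n) (_ : IsBestArm A μ b) (i : Fin n) (_ : i ≠ b),
    ENNReal.ofReal
      ((armMean A μ b - armMean A μ i) ^ 2 / (2 * ∑ j, (A j b - A j i) ^ 2 / w j))

/-- The characteristic time `T^*(μ, A)`; its inverse is the supremum over arm proportions
`w ∈ Δ^{n-1}` of the objective at the context frequencies `(∑_l w_l A_{j,l})_j`. -/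
noncomputable def charTime (A : Matrix (Fin k) (Fin n) ℝ) (μ : Fin k → ℝ) : ℝ≥0∞ :=
  (⨆ w ∈ stdSimplex ℝ (Fin n), objective A μ (A *ᵥ w))⁻¹

/-- The set of optimal context frequencies: the maximizers of the objective over the policy
space. -/
def optimalFrequencies (A : Matrix (Fin k) (Fin n) ℝ) (μ : Fin k → ℝ) : Set (Fin k → ℝ) :=
  {w | w ∈ policySpace A ∧ ∀ w' ∈ policySpace A, objective A μ w' ≤ objective A μ w}

/-- What is observed in one round: the arm pulled, the context, and the reward. -/
abbrev Round (n k : ℕ) : Type := Fin n × Fin k × ℝ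

/-- The history of the first `t` rounds. -/
abbrev History (n k t : ℕ) : Type := Fin t → Round n k

/-- `N^Z_j(t)`: the number of observations of context `j`. -/
def contextCount {t : ℕ} (h : History n k t) (j : Fin k) : ℕ :=
  (Finset.univ.filter fun s : Fin t => (h s).2.1 = j).card

/-- The observed context frequencies `N^Z(t) / t`. -/
noncomputable def contextFreq {t : ℕ} (h : History n k t) : Fin k → ℝ :=
  fun j => (contextCount h j : ℝ) / t

/-- The empirical reward means `μ̂(t)`, one for each context. -/
noncomputable def empMean {t : ℕ} (h : History n k t) : Fin k → ℝ :=
  fun j => (∑ s ∈ Finset.univ.filter (fun s : Fin t => (h s).2.1 = j), (h s).2.2) /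
    contextCount h j

/-- The initialization phase is over: every context has been observed. -/
def InitDone {t : ℕ} (h : History n k t) : Prop :=
  ∀ j, 0 < contextCount h j

/-- The point `p` is obtained by extending the ray from `v` through `w ∈ policySpace A` until it
leaves the policy space. If `v = w` there is no ray, and no condition is imposed. -/
def IsGTrackingPoint (A : Matrix (Fin k) (Fin n) ℝ) (v w p : Fin k → ℝ) : Prop :=
  v ≠ w → ∃ s : ℝ, 1 ≤ s ∧ p = v + s • (w - v) ∧ p ∈ policySpace A ∧
    ∀ s' : ℝ, s < s' → v + s' • (w - v) ∉ policySpace A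

/-- The sampling rule of the Separator Track and Stop algorithm. After the history `h` of `t`
rounds the next arm is drawn from the distribution `armDist t h`, so that the policy played is
`A *ᵥ armDist t h`. The arms are arbitrary during initialization; afterwards, whenever the empirical
means determine a unique best arm, the policy is the G-tracking point for some optimal context
frequency vector of the empirical means. -/
structure SamplingRule (A : Matrix (Fin k) (Fin n) ℝ) where
  armDist : (t : ℕ) → History n k t → Fin n → ℝ
  measurable_armDist : ∀ t, Measurable (armDist t)
  armDist_mem : ∀ t h, armDist t h ∈ stdSimplex ℝ (Fin n)
  tracking : ∀ t (h : History n k t), InitDone h → empMean h ∈ uniqueBest A →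
    ∃ w ∈ optimalFrequencies A (empMean h),
      IsGTrackingPoint A (contextFreq h) w (A *ᵥ armDist t h)

/-- The history of the first `t` rounds of a process of rounds. -/
def history {Ω : Type*} (R : ℕ → Ω → Round n k) (t : ℕ) (ω : Ω) : History n k t :=
  fun s => R s ω

/-- The process of rounds `R` on the probability space `(Ω, P)` is the interaction of the sampling
rule `alg` with the instance `(A, μ)`: given the history of the first `t` rounds, the next arm is
`i` with probability `armDist t h i`; given this arm, the context is `j` with probability `A j i`;
and given the context `j` the reward has law `N(μ j, 1)`. -/
structure IsInteraction {Ω : Type*} [MeasurableSpace Ω] (P : Measure Ω)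
    {A : Matrix (Fin k) (Fin n) ℝ} (alg : SamplingRule A) (μ : Fin k → ℝ)
    (R : ℕ → Ω → Round n k) : Prop where
  measurable : ∀ t, Measurable (R t)
  law : ∀ (t : ℕ) (H : Set (History n k t)), MeasurableSet H → ∀ (i : Fin n) (j : Fin k)
    (B : Set ℝ), MeasurableSet B →
    P {ω | history R t ω ∈ H ∧ (R t ω).1 = i ∧ (R t ω).2.1 = j ∧ (R t ω).2.2 ∈ B} =
      (∫⁻ ω in {ω | history R t ω ∈ H}, ENNReal.ofReal (alg.armDist t (history R t ω) i) ∂P) *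
        ENNReal.ofReal (A j i) * gaussianReal (μ j) 1 B

open scoped Classical in
/-- The generalized likelihood ratio statistic
`Λ(t) = inf_{μ' ∈ Alt(μ̂(t), A)} ∑_j N^Z_j(t) (μ̂_j(t) - μ'_j)² / 2` if `μ̂(t) ∈ I(A)`, and `0`
otherwise. -/
noncomputable def glr (A : Matrix (Fin k) (Fin n) ℝ) {t : ℕ} (h : History n k t) : EReal :=
  if empMean h ∈ uniqueBest A then
    ⨅ μ' ∈ alternatives A (empMean h),
      ((∑ j, (contextCount h j : ℝ) * ((empMean h j - μ' j) ^ 2 / 2) : ℝ) : EReal)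
  else 0

/-- `g(x) = 2x - 2x ln(4x) + ln ζ(2x) - (1/2) ln(1 - x)` for `1/2 < x < 1`. -/
noncomputable def gFun (x : ℝ) : ℝ :=
  2 * x - 2 * x * Real.log (4 * x) + Real.log (riemannZeta ((2 * x : ℝ) : ℂ)).re
    - 1 / 2 * Real.log (1 - x)

/-- `C^g(x) = min_{l ∈ (1/2, 1]} (g(l) + x) / l`. As `g(1) = +∞`, the endpoint `1` does not
contribute to the minimum. -/
noncomputable def cg (x : ℝ) : ℝ :=
  sInf ((fun l : ℝ => (gFun l + x) / l) '' Set.Ioo (1 / 2) 1)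

/-- The threshold `c_t(δ) = 2 ∑_j ln(4 + ln N^Z_j(t)) + k C^g(ln(1/δ) / k)`. -/
noncomputable def threshold {t : ℕ} (h : History n k t) (δ : ℝ) : ℝ :=
  2 * ∑ j, Real.log (4 + Real.log (contextCount h j)) + k * cg (Real.log (1 / δ) / k)

/-- The stopping time `τ_δ`: the first time `t`, from the end of the initialization phase on, at
which `Λ(t) > c_t(δ)` (`∞` if there is none). -/
noncomputable def stoppingTime (A : Matrix (Fin k) (Fin n) ℝ) {Ω : Type*}
    (R : ℕ → Ω → Round n k) (δ : ℝ) (ω : Ω) : ℕ∞ :=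
  ⨅ (t : ℕ) (_ : InitDone (history R t ω) ∧
    (threshold (history R t ω) δ : EReal) < glr A (history R t ω)), (t : ℕ∞)

end SeparatorBandit

/-! Let `V(μ, w) = max_i (∑_j (A_{j,b} - A_{j,i})² / w_j) / Δ_i²` (`complexity`), so that `1 / F = 2
V` and `T^*` is the infimum of `2 V(μ, A w)` over the simplex. `V` is convex and coordinatewise
decreasing in `w`, and stable up to factors near `1` when `μ` or `w` is perturbed.

Cauchy-Schwarz gives `Λ(t) ≥ t / (2 V(μ̂(t), N^Z(t)/t))` (`le_glr`), while the threshold is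
`ln(1/δ)` up to a factor near `1` and a sublinear term in `t` (`exists_threshold_le`). It remains to
show that `V` at the observed frequencies is eventually at most nearly `V(μ, w₀)`, for every `w₀` in
the policy space.

The observed frequencies need not stay in the policy space, so the potential is evaluated at the
average policy `U(t)`, which does. Martingale concentration makes `N^Z(t)/t - U(t)` and `μ̂(t) - μ`
small. A G-tracking move from `v = N^Z(t)/t` through `w^*` makes `U(t+1)` a convex combination of
`U(t)` and a point near `w^*`, with weight at least `1/(t+1)` on the latter, unless `v` is already
near `w^*`. By convexity, `t` times the positive part of the excess of `V(μ, U(t))` over a level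
slightly above `V(μ, w₀)` does not increase (`complexity_step`, `exists_complexity_contextFreq_le`).
The excess thus decays like `t₀ / t` from a random time `t₀` after which there are no deviations.

This `t₀` has finite expectation and does not depend on `δ`. Solving "threshold below `t / (2B)`"
for `t` bounds `E[τ_δ]` by a constant plus a multiple of `ln(1/δ)`; the multiple tends to `2 V(μ,
w₀)` as the slack `q` tends to `1`. -/

namespace SeparatorBandit

/-! ### Complexity: monotonicity, convexity, relation to the objective. -/

variable {n k : ℕ}

/-- The reciprocal of twice the objective, as a real number, when `b` is the best arm:
`max_i (∑_j (A_{j,b} - A_{j,i})² / w_j) / Δ_i²` (the term `i = b` is `0`). -/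
noncomputable def complexity (A : Matrix (Fin k) (Fin n) ℝ) (μ : Fin k → ℝ) (b : Fin n)
    (w : Fin k → ℝ) : ℝ :=
  ⨆ i, (∑ j, (A j b - A j i) ^ 2 / w j) / (armMean A μ b - armMean A μ i) ^ 2

variable {A : Matrix (Fin k) (Fin n) ℝ} {μ μ' u w : Fin k → ℝ} {b : Fin n}

lemma le_complexity (A : Matrix (Fin k) (Fin n) ℝ) (μ w : Fin k → ℝ) (b i : Fin n) :
    (∑ j, (A j b - A j i) ^ 2 / w j) / (armMean A μ b - armMean A μ i) ^ 2
      ≤ complexity A μ b w :=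
  le_ciSup (f := fun i => (∑ j, (A j b - A j i) ^ 2 / w j) / (armMean A μ b - armMean A μ i) ^ 2)
    (Set.finite_range _).bddAbove i

lemma complexity_le {x : ℝ}
    (h : ∀ i, (∑ j, (A j b - A j i) ^ 2 / w j) / (armMean A μ b - armMean A μ i) ^ 2 ≤ x) :
    complexity A μ b w ≤ x :=
  have : Nonempty (Fin n) := ⟨b⟩
  ciSup_le h

lemma complexity_nonneg (A : Matrix (Fin k) (Fin n) ℝ) (μ w : Fin k → ℝ) (b : Fin n) :
    0 ≤ complexity A μ b w := by
  simpa using le_complexity A μ w b b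

/-- Decreasing the frequencies by a factor `q` at most multiplies the complexity by `1 / q`. -/
lemma mul_complexity_le_of_freq {q : ℝ} (hq : 0 < q) (hu : ∀ j, 0 < u j)
    (h : ∀ j, q * u j ≤ w j) : q * complexity A μ b w ≤ complexity A μ b u := by
  rw [← le_div_iff₀' hq]
  refine complexity_le fun i => ?_
  rw [le_div_iff₀' hq, ← mul_div_assoc]
  refine le_trans ?_ (le_complexity A μ u b i)
  gcongr
  rw [Finset.mul_sum]
  refine Finset.sum_le_sum fun j _ => ?_
  have h1 : 0 < q * u j := mul_pos hq (hu j)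
  calc q * ((A j b - A j i) ^ 2 / w j) ≤ q * ((A j b - A j i) ^ 2 / (q * u j)) := by
        gcongr; exact h j
    _ = (A j b - A j i) ^ 2 / u j := by
        have := (hu j).ne'
        field_simp

lemma mul_complexity_le_of_gap {q : ℝ} (hq : 0 < q) (hw : ∀ j, 0 < w j) (hb : IsBestArm A μ b)
    (h : ∀ i, q * (armMean A μ b - armMean A μ i) ^ 2 ≤
      (armMean A μ' b - armMean A μ' i) ^ 2) :
    q * complexity A μ' b w ≤ complexity A μ b w := by
  rw [← le_div_iff₀' hq]
  refine complexity_le fun i => ?_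
  rw [le_div_iff₀' hq]
  refine le_trans ?_ (le_complexity A μ w b i)
  by_cases hi : i = b
  · subst hi; simp
  have hg : 0 < (armMean A μ b - armMean A μ i) ^ 2 := by
    have := hb i hi
    exact pow_pos (by linarith) 2
  have hS : 0 ≤ ∑ j, (A j b - A j i) ^ 2 / w j :=
    Finset.sum_nonneg fun j _ => div_nonneg (sq_nonneg _) (hw j).le
  calc q * ((∑ j, (A j b - A j i) ^ 2 / w j) / (armMean A μ' b - armMean A μ' i) ^ 2)
      ≤ q * ((∑ j, (A j b - A j i) ^ 2 / w j) / (q * (armMean A μ b - armMean A μ i) ^ 2)) := by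
        gcongr; exact h i
    _ = _ := by field_simp

/-- Each term is a nonnegative combination of the convex functions `1 / w_j`, and a maximum of
convex functions is convex. -/
lemma complexity_convex {x : ℝ} (hx0 : 0 ≤ x) (hx1 : x ≤ 1) (hu : ∀ j, 0 < u j)
    (hw : ∀ j, 0 < w j) :
    complexity A μ b (fun j => (1 - x) * u j + x * w j) ≤
      (1 - x) * complexity A μ b u + x * complexity A μ b w := by
  refine complexity_le fun i => ?_
  have h1 := mul_le_mul_of_nonneg_left (le_complexity A μ u b i) (sub_nonneg.2 hx1)
  have h2 := mul_le_mul_of_nonneg_left (le_complexity A μ w b i) hx0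
  refine le_trans ?_ (add_le_add h1 h2)
  rw [← mul_div_assoc, ← mul_div_assoc, ← add_div]
  gcongr
  rw [Finset.mul_sum, Finset.mul_sum, ← Finset.sum_add_distrib]
  refine Finset.sum_le_sum fun j _ => ?_
  have hc := (convexOn_zpow (𝕜 := ℝ) (-1)).2 (hu j) (hw j) (sub_nonneg.2 hx1) hx0 (by ring)
  simp only [zpow_neg_one, smul_eq_mul] at hc
  calc (A j b - A j i) ^ 2 / ((1 - x) * u j + x * w j)
      ≤ (A j b - A j i) ^ 2 * ((1 - x) * (u j)⁻¹ + x * (w j)⁻¹) := by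
        rw [div_eq_mul_inv]; gcongr
    _ = _ := by ring

lemma IsBestArm.eq {c : Fin n} (hb : IsBestArm A μ b) (hc : IsBestArm A μ c) : c = b := by
  by_contra h
  exact lt_asymm (hb c h) (hc b (Ne.symm h))

lemma inv_objective (hb : IsBestArm A μ b) (hw : ∀ j, 0 < w j) :
    (objective A μ w)⁻¹ = ENNReal.ofReal (2 * complexity A μ b w) := by
  have hobj : objective A μ w = ⨅ (i : Fin n) (_ : i ≠ b), ENNReal.ofReal
      ((armMean A μ b - armMean A μ i) ^ 2 / (2 * ∑ j, (A j b - A j i) ^ 2 / w j)) := by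
    refine le_antisymm (iInf₂_le b hb) (le_iInf₂ fun c hc => ?_)
    rw [hb.eq hc]
  have key : ∀ i, i ≠ b → (ENNReal.ofReal
      ((armMean A μ b - armMean A μ i) ^ 2 / (2 * ∑ j, (A j b - A j i) ^ 2 / w j)))⁻¹ =
      ENNReal.ofReal (2 * ((∑ j, (A j b - A j i) ^ 2 / w j) /
        (armMean A μ b - armMean A μ i) ^ 2)) := by
    intro i hi
    have hg : 0 < armMean A μ b - armMean A μ i := sub_pos.2 (hb i hi)
    -- If the sum vanished, columns `b` and `i` would coincide and the gap would be zero.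
    have hS : 0 < ∑ j, (A j b - A j i) ^ 2 / w j := by
      have h0 : ∀ j ∈ Finset.univ, 0 ≤ (A j b - A j i) ^ 2 / w j :=
        fun j _ => div_nonneg (sq_nonneg _) (hw j).le
      refine lt_of_le_of_ne (Finset.sum_nonneg h0) fun h => hg.ne' ?_
      have := (Finset.sum_eq_zero_iff_of_nonneg h0).1 h.symm
      rw [armMean, armMean, ← Finset.sum_sub_distrib]
      refine Finset.sum_eq_zero fun j hj => ?_
      have h2 := this j hj
      rw [div_eq_zero_iff, or_iff_left (hw j).ne'] at h2
      rw [← sub_mul, pow_eq_zero_iff two_ne_zero |>.1 h2, zero_mul]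
    rw [← ENNReal.ofReal_inv_of_pos (by positivity), inv_div, mul_div_assoc]
  rw [hobj, ENNReal.inv_iInf]
  simp_rw [ENNReal.inv_iInf]
  refine le_antisymm (iSup₂_le fun i hi => ?_) ?_
  · rw [key i hi]
    exact ENNReal.ofReal_le_ofReal (mul_le_mul_of_nonneg_left (le_complexity A μ w b i) two_pos.le)
  · have : Nonempty (Fin n) := ⟨b⟩
    obtain ⟨i, hi⟩ := exists_eq_ciSup_of_finite (f := fun i =>
      (∑ j, (A j b - A j i) ^ 2 / w j) / (armMean A μ b - armMean A μ i) ^ 2)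
    have hi' : complexity A μ b w = (∑ j, (A j b - A j i) ^ 2 / w j) /
      (armMean A μ b - armMean A μ i) ^ 2 := hi.symm
    -- The maximum may sit at `i = b`, for instance with a single arm; then the complexity is `0`
    -- and the bound is trivial.
    by_cases h : i = b
    · subst h
      rw [hi']; simp
    · rw [hi', ← key i h]
      exact le_iSup₂ (f := fun i (_ : i ≠ b) => (ENNReal.ofReal
        ((armMean A μ b - armMean A μ i) ^ 2 / (2 * ∑ j, (A j b - A j i) ^ 2 / w j)))⁻¹) i h

/-! ### The likelihood ratio statistic and the threshold. -/

/-- A lower bound for the generalized likelihood ratio statistic. -/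
lemma le_glr {t : ℕ} {h : History n k t} (hI : InitDone h) (hb : IsBestArm A (empMean h) b)
    (ht : 0 < t) {x : ℝ} (hx : x * (2 * complexity A (empMean h) b (contextFreq h)) ≤ t) :
    (x : EReal) ≤ glr A h := by
  rw [glr, if_pos ⟨b, hb⟩]
  refine le_iInf₂ fun μ' hμ' => EReal.coe_le_coe_iff.2 ?_
  have h1 := hμ'.2 b hb
  rw [IsBestArm] at h1
  push Not at h1
  -- Under an alternative some arm `i` is at least as good as `b`, so moving from the empirical
  -- means to `μ'` must close the whole gap `g`; Cauchy-Schwarz with weights `N_j` prices this move.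
  obtain ⟨i, hib, hi⟩ := h1
  have hg : 0 < armMean A (empMean h) b - armMean A (empMean h) i := sub_pos.2 (hb i hib)
  rcases le_or_gt x 0 with hx0 | hx0
  · exact hx0.trans (Finset.sum_nonneg fun j _ => by positivity)
  have hN : ∀ j, (0 : ℝ) < contextCount h j := fun j => by exact_mod_cast hI j
  have ht' : (0 : ℝ) < t := by exact_mod_cast ht
  set g := armMean A (empMean h) b - armMean A (empMean h) i with hgdef
  set S := ∑ j, (A j b - A j i) ^ 2 / (contextCount h j : ℝ) with hS
  set Q := ∑ j, (contextCount h j : ℝ) * (empMean h j - μ' j) ^ 2 with hQ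
  have hQ2 : ∑ j, (contextCount h j : ℝ) * ((empMean h j - μ' j) ^ 2 / 2) = Q / 2 := by
    rw [hQ, Finset.sum_div]
    exact Finset.sum_congr rfl fun j _ => by ring
  have hcs : (∑ j, (A j b - A j i) * (empMean h j - μ' j)) ^ 2 ≤ S * Q := by
    refine Finset.sum_sq_le_sum_mul_sum_of_sq_le_mul _
      (fun j _ => div_nonneg (sq_nonneg _) (hN j).le)
      (fun j _ => mul_nonneg (hN j).le (sq_nonneg _)) fun j _ => ?_
    have := (hN j).ne'
    exact le_of_eq (by field_simp)
  have hge : g ≤ ∑ j, (A j b - A j i) * (empMean h j - μ' j) := by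
    have : ∑ j, (A j b - A j i) * (empMean h j - μ' j) =
        g - (armMean A μ' b - armMean A μ' i) := by
      simp only [hgdef, armMean, ← Finset.sum_sub_distrib]
      exact Finset.sum_congr rfl fun j _ => by ring
    linarith
  have hg2 : g ^ 2 ≤ S * Q := (pow_le_pow_left₀ hg.le hge 2).trans hcs
  have hSt : ∑ j, (A j b - A j i) ^ 2 / contextFreq h j = t * S := by
    rw [hS, Finset.mul_sum]
    refine Finset.sum_congr rfl fun j _ => ?_
    rw [contextFreq]
    have := (hN j).ne'
    field_simp
  have hle := le_complexity A (empMean h) (contextFreq h) b i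
  rw [hSt, ← hgdef, div_le_iff₀ (by positivity)] at hle
  have hSpos : 0 < S := by
    have h0 : 0 ≤ S := Finset.sum_nonneg fun j _ => div_nonneg (sq_nonneg _) (hN j).le
    rcases h0.eq_or_lt with h0 | h0
    · rw [← h0, zero_mul] at hg2
      nlinarith
    · exact h0
  rw [hQ2]
  set C := complexity A (empMean h) b (contextFreq h)
  have h3 : x * 2 * (t * S) ≤ t * (S * Q) :=
    calc x * 2 * (t * S) ≤ x * 2 * (C * g ^ 2) := by gcongr
      _ = x * (2 * C) * g ^ 2 := by ring
      _ ≤ t * (S * Q) := by gcongr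
  have h4 : 0 < t * S := by positivity
  have h5 : x * 2 ≤ Q := le_of_mul_le_mul_right (by linarith) h4
  linarith

lemma contextCount_le {t : ℕ} (h : History n k t) (j : Fin k) : contextCount h j ≤ t :=
  (Finset.card_filter_le _ _).trans (by simp)

lemma cg_le {q x : ℝ} (hq : q ∈ Set.Ioo (1 / 2 : ℝ) 1) (hx : 0 ≤ x) :
    cg x ≤ (|gFun q| + x) / q := by
  have hq0 : 0 < q := lt_trans (by norm_num) hq.1
  by_cases hb : BddBelow ((fun l : ℝ => (gFun l + x) / l) '' Set.Ioo (1 / 2) 1)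
  · refine (csInf_le hb ⟨q, hq, rfl⟩).trans ?_
    dsimp only
    gcongr
    exact le_abs_self _
  -- For a set unbounded below `sInf` is `0`; the absolute value in the bound covers this case too.
  · rw [cg, Real.sInf_of_not_bddBelow hb]
    positivity

lemma threshold_le {t : ℕ} {h : History n k t} (hI : InitDone h) (hk : 0 < k) {q δ : ℝ}
    (hq : q ∈ Set.Ioo (1 / 2 : ℝ) 1) (hδ : 0 ≤ Real.log (1 / δ)) :
    threshold h δ ≤ 2 * k * (3 + Real.log t) + (k * |gFun q| + Real.log (1 / δ)) / q := by
  have hq0 : 0 < q := lt_trans (by norm_num) hq.1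
  have hk' : (0 : ℝ) < k := by exact_mod_cast hk
  rw [threshold]
  refine add_le_add ?_ ?_
  · have : ∀ j ∈ Finset.univ, Real.log (4 + Real.log (contextCount h j)) ≤ 3 + Real.log t := by
      intro j _
      have hN : (1 : ℝ) ≤ contextCount h j := by exact_mod_cast hI j
      have h1 : Real.log (contextCount h j) ≤ Real.log t := by
        gcongr; exact contextCount_le h j
      have h2 := Real.log_nonneg hN
      have h3 := Real.log_le_sub_one_of_pos (show 0 < 4 + Real.log (contextCount h j) by linarith)
      linarith
    have := Finset.sum_le_sum this
    rw [Finset.sum_const, Finset.card_univ, Fintype.card_fin, nsmul_eq_mul] at this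
    linarith
  · calc (k : ℝ) * cg (Real.log (1 / δ) / k)
        ≤ k * ((|gFun q| + Real.log (1 / δ) / k) / q) := by
          gcongr; exact cg_le hq (by positivity)
      _ = _ := by field_simp

/-! ### The policy space and its coordinate bounds. -/

lemma mulVec_mem_policySpace (A : Matrix (Fin k) (Fin n) ℝ) {p : Fin n → ℝ}
    (hp : p ∈ stdSimplex ℝ (Fin n)) : A *ᵥ p ∈ policySpace A := by
  have h := (convex_convexHull ℝ (Set.range fun i : Fin n => fun j : Fin k => A j i)).sum_mem
    (t := Finset.univ) (w := p) (z := fun i j => A j i) (fun i _ => hp.1 i) hp.2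
    (fun i _ => subset_convexHull ℝ _ ⟨i, rfl⟩)
  have heq : A *ᵥ p = ∑ i, p i • fun j => A j i := by
    funext j
    rw [Finset.sum_apply]
    simp only [Matrix.mulVec, dotProduct, Pi.smul_apply, smul_eq_mul]
    exact Finset.sum_congr rfl fun i _ => mul_comm (A j i) (p i)
  rw [heq]
  exact h

lemma bounds_of_mem_policySpace {x y : ℝ} (hA : ∀ j i, A j i ∈ Set.Icc x y)
    (hw : w ∈ policySpace A) (j : Fin k) : w j ∈ Set.Icc x y := by
  have hc : Convex ℝ {w : Fin k → ℝ | ∀ j, w j ∈ Set.Icc x y} := by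
    have : {w : Fin k → ℝ | ∀ j, w j ∈ Set.Icc x y} = Set.univ.pi fun _ => Set.Icc x y := by
      ext w; exact ⟨fun h j _ => h j, fun h j => h j trivial⟩
    rw [this]
    exact convex_pi fun _ _ => convex_Icc _ _
  refine convexHull_min ?_ hc hw j
  rintro _ ⟨i, rfl⟩ j
  exact hA j i

lemma IsContextMatrix.exists_bounds (hA : IsContextMatrix A) :
    ∃ a : ℝ, 0 < a ∧ ∀ j i, A j i ∈ Set.Icc a 1 := by
  have hle : ∀ j i, A j i ≤ 1 := fun j i => by
    rw [← hA.sum_eq_one i]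
    exact Finset.single_le_sum (f := fun j => A j i) (fun j _ => (hA.pos j i).le)
      (Finset.mem_univ j)
  rcases isEmpty_or_nonempty (Fin k × Fin n) with h | h
  · exact ⟨1, one_pos, fun j i => (h.false (j, i)).elim⟩
  · obtain ⟨x, hx⟩ := Finite.exists_min fun x : Fin k × Fin n => A x.1 x.2
    exact ⟨A x.1 x.2, hA.pos _ _, fun j i => ⟨hx (j, i), hle j i⟩⟩

/-! ### Stability in the means and the G-tracking contraction. -/

/-- Means close to `μ` have the same best arm and nearly the same complexities. -/
lemma exists_radius (hb : IsBestArm A μ b) {q : ℝ} (hq0 : 0 < q) (hq1 : q < 1) :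
    ∃ ξ > 0, ∀ μ' : Fin k → ℝ, (∀ j, |μ' j - μ j| < ξ) → IsBestArm A μ' b ∧
      ∀ w : Fin k → ℝ, (∀ j, 0 < w j) → q * complexity A μ' b w ≤ complexity A μ b w ∧
        q * complexity A μ b w ≤ complexity A μ' b w := by
  have hcont : ∀ i, Continuous fun μ' : Fin k → ℝ =>
      |(armMean A μ' b - armMean A μ' i) - (armMean A μ b - armMean A μ i)| := by
    intro i
    unfold armMean
    fun_prop
  have hev : ∀ᶠ μ' in 𝓝 μ, ∀ i,
      |(armMean A μ' b - armMean A μ' i) - (armMean A μ b - armMean A μ i)| ≤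
        (1 - q) / 2 * (armMean A μ b - armMean A μ i) := by
    refine eventually_all.2 fun i => ?_
    by_cases hi : i = b
    · subst hi; simp
    · have h0 : |(armMean A μ b - armMean A μ i) - (armMean A μ b - armMean A μ i)| <
          (1 - q) / 2 * (armMean A μ b - armMean A μ i) := by
        rw [sub_self, abs_zero]
        exact mul_pos (by linarith) (sub_pos.2 (hb i hi))
      exact ((hcont i).continuousAt.eventually_lt_const h0).mono fun _ h => le_of_lt h
  obtain ⟨ξ, hξ, hball⟩ := Metric.eventually_nhds_iff.1 hev
  refine ⟨ξ, hξ, fun μ' hμ' => ?_⟩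
  have hclose := hball (y := μ') ((dist_pi_lt_iff hξ).2 fun j => by
    rw [Real.dist_eq]; exact hμ' j)
  have hg : ∀ i, 0 ≤ armMean A μ b - armMean A μ i := fun i => by
    by_cases hi : i = b
    · subst hi; simp
    · exact (sub_pos.2 (hb i hi)).le
  have hb' : IsBestArm A μ' b := by
    intro i hi
    have h1 := (abs_le.1 (hclose i)).1
    have h2 := sub_pos.2 (hb i hi)
    nlinarith
  refine ⟨hb', fun w hw => ⟨mul_complexity_le_of_gap hq0 hw hb fun i => ?_,
    mul_complexity_le_of_gap hq0 hw hb' fun i => ?_⟩⟩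
  · have h1 := (abs_le.1 (hclose i)).1
    set g := armMean A μ b - armMean A μ i
    set g' := armMean A μ' b - armMean A μ' i
    have h2 : (1 + q) / 2 * g ≤ g' := by linarith
    have h3 : ((1 + q) / 2 * g) ^ 2 ≤ g' ^ 2 :=
      pow_le_pow_left₀ (mul_nonneg (by linarith) (hg i)) h2 2
    nlinarith [mul_nonneg (sq_nonneg (1 - q)) (sq_nonneg g)]
  · have h1 := (abs_le.1 (hclose i)).1
    have h1' := (abs_le.1 (hclose i)).2
    have hgi := hg i
    set g := armMean A μ b - armMean A μ i
    set g' := armMean A μ' b - armMean A μ' i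
    have h2 : g' ≤ (3 - q) / 2 * g := by linarith
    have h4 : 0 ≤ g' := by nlinarith
    have h3 : g' ^ 2 ≤ ((3 - q) / 2 * g) ^ 2 := pow_le_pow_left₀ h4 h2 2
    -- This is the identity `4 - q (3 - q)² = (1 - q)² (4 - q)`.
    have h5 : q * ((3 - q) / 2) ^ 2 ≤ 1 := by
      nlinarith [mul_nonneg (sq_nonneg (1 - q)) (show 0 ≤ 4 - q by linarith)]
    calc q * g' ^ 2 ≤ q * ((3 - q) / 2 * g) ^ 2 := by gcongr
      _ = (q * ((3 - q) / 2) ^ 2) * g ^ 2 := by ring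
      _ ≤ 1 * g ^ 2 := by gcongr
      _ = g ^ 2 := one_mul _

/-- One step of the averaged policies under G-tracking: the excess over a level `c` of the
complexity contracts. -/
lemma complexity_step {q a η c θ : ℝ} {v p : Fin k → ℝ} (hq0 : 0 < q) (hη0 : 0 < η)
    (hη : 3 * η ≤ (1 - q) * a) (hθ0 : 0 < θ) (hθ1 : θ ≤ 1) (hθη : θ ≤ η)
    (hu : ∀ j, u j ∈ Set.Icc a 1) (hv : ∀ j, v j ∈ Set.Icc 0 1) (hp : ∀ j, p j ∈ Set.Icc 0 1)
    (ha : 0 < a) (hw : ∀ j, a ≤ w j) (huv : ∀ j, |v j - u j| ≤ η)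
    (hc : complexity A μ b w ≤ q * c)
    (htrack : v ≠ w → ∃ s : ℝ, 1 ≤ s ∧ p = v + s • (w - v)) :
    complexity A μ b (fun j => u j + θ * (p j - u j)) - c ≤
      (1 - θ) * max (complexity A μ b u - c) 0 := by
  have hw0 : ∀ j, 0 < w j := fun j => ha.trans_le (hw j)
  have hu0 : ∀ j, 0 < u j := fun j => ha.trans_le (hu j).1
  -- As `w_j ≥ a` and `3η ≤ (1 - q) a`, such a `y` satisfies `y ≥ q w`, and the margin `q` in `hc`
  -- pays for this.
  have near : ∀ y : Fin k → ℝ, (∀ j, w j - 3 * η ≤ y j) → complexity A μ b y ≤ c := by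
    intro y hy
    have hq1 : 0 < 1 - q := by
      by_contra h
      nlinarith
    have := mul_complexity_le_of_freq (A := A) (μ := μ) (b := b) hq0 hw0 (w := y) fun j => by
      have h1 := hy j
      have h2 := hw j
      nlinarith
    exact le_of_mul_le_mul_left (this.trans hc) hq0
  have hR : 0 ≤ (1 - θ) * max (complexity A μ b u - c) 0 :=
    mul_nonneg (by linarith) (le_max_right _ _)
  by_cases hcase : ∀ j, |w j - v j| < η
  -- The new average may fall below `w` by `η` for `w - v`, `η` for `v - u`, and `θ ≤ η` for the
  -- step itself.
  · refine (sub_nonpos.2 (near _ fun j => ?_)).trans hR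
    have h1 := abs_lt.1 (hcase j)
    have h2 := abs_le.1 (huv j)
    have h3 := (hp j).1
    have h4 := (hu j).2
    nlinarith
  · push Not at hcase
    obtain ⟨j₀, hj₀⟩ := hcase
    have hvw : v ≠ w := fun h => by
      rw [h, sub_self, abs_zero] at hj₀
      linarith
    obtain ⟨s, hs, hps⟩ := htrack hvw
    have hs0 : 0 < s := by linarith
    -- Both `p` and `v` lie in the unit cube, so a coordinate where `w - v` is at least `η` limits
    -- the extension factor to `1 / η`.
    have hsη : s * η ≤ 1 := by
      have h1 : s * |w j₀ - v j₀| = |p j₀ - v j₀| := by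
        rw [hps]
        simp [abs_mul, abs_of_pos hs0]
      have h2 : |p j₀ - v j₀| ≤ 1 := by
        have := hp j₀
        have := hv j₀
        simp only [Set.mem_Icc] at *
        exact abs_le.2 ⟨by linarith, by linarith⟩
      nlinarith
    have hsθ : θ * s ≤ 1 := by nlinarith
    -- The ray starts at `v`, not at `u`; `y` is the solution of `u + θ (p - u) = (1 - θ s) u + θ s
    -- y`, and it stays within `η` of `w`.
    set y : Fin k → ℝ := fun j => w j - (s - 1) / s * (v j - u j) with hy
    have hr0 : 0 ≤ (s - 1) / s := div_nonneg (by linarith) hs0.le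
    have hr1 : (s - 1) / s ≤ 1 := by rw [div_le_one hs0]; linarith
    have hyw : ∀ j, w j - η ≤ y j := fun j => by
      have h2 := abs_le.1 (huv j)
      simp only [hy]
      nlinarith
    have hq1 : (1 - q) * a ≤ a := by nlinarith
    have hy0 : ∀ j, 0 < y j := fun j => by
      have := hyw j
      have := hw j
      linarith
    have hyc : complexity A μ b y ≤ c := near y fun j => by
      have := hyw j
      linarith
    have heq : (fun j => u j + θ * (p j - u j)) =
        fun j => (1 - θ * s) * u j + (θ * s) * y j := by
      ext j
      simp only [hps, hy, Pi.add_apply, Pi.smul_apply, Pi.sub_apply, smul_eq_mul]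
      field_simp
      ring
    rw [heq]
    have h1 := complexity_convex (A := A) (μ := μ) (b := b) (by positivity) hsθ hu0 hy0
    have h2 : complexity A μ b u - c ≤ max (complexity A μ b u - c) 0 := le_max_left _ _
    have h3 : 0 ≤ max (complexity A μ b u - c) 0 := le_max_right _ _
    have h4 : θ * s * complexity A μ b y ≤ θ * s * c := by gcongr
    have h5 : (1 - θ * s) * (complexity A μ b u - c) ≤
        (1 - θ * s) * max (complexity A μ b u - c) 0 :=
      mul_le_mul_of_nonneg_left h2 (by linarith)
    have h6 : θ * 1 ≤ θ * s := by gcongr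
    nlinarith

end SeparatorBandit

/-! ### Conditional laws and exponential moments. -/

namespace SeparatorBandit

variable {n k : ℕ}
variable {A : Matrix (Fin k) (Fin n) ℝ} {μ : Fin k → ℝ} {alg : SamplingRule A}
  {Ω : Type*} [MeasurableSpace Ω] {P : Measure Ω} {R : ℕ → Ω → Round n k}

lemma IsInteraction.measurable_history (hR : IsInteraction P alg μ R) (t : ℕ) :
    Measurable (history R t) :=
  measurable_pi_lambda _ fun s => hR.measurable s

lemma SamplingRule.measurable_armDist_apply (alg : SamplingRule A) (t : ℕ) (i : Fin n) :
    Measurable fun h => alg.armDist t h i :=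
  (measurable_pi_apply i).comp (alg.measurable_armDist t)

/-- The joint law of the history and of the reward, on the event that arm `i` and context `j`
are observed. -/
lemma IsInteraction.map_restrict [IsProbabilityMeasure P] (hR : IsInteraction P alg μ R)
    (t : ℕ) (i : Fin n) (j : Fin k) :
    (P.restrict {ω | (R t ω).1 = i ∧ (R t ω).2.1 = j}).map
      (fun ω => (history R t ω, (R t ω).2.2)) =
    ((P.map (history R t)).withDensity fun h =>
      ENNReal.ofReal (A j i) * ENNReal.ofReal (alg.armDist t h i)).prod
      (gaussianReal (μ j) 1) := by
  have hh := hR.measurable_history t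
  have hm := hR.measurable t
  have hd : Measurable fun h : History n k t => ENNReal.ofReal (alg.armDist t h i) :=
    (alg.measurable_armDist_apply t i).ennreal_ofReal
  have : IsProbabilityMeasure (P.map (history R t)) :=
    Measure.isProbabilityMeasure_map hh.aemeasurable
  have : IsFiniteMeasure ((P.map (history R t)).withDensity fun h =>
      ENNReal.ofReal (A j i) * ENNReal.ofReal (alg.armDist t h i)) := by
    refine isFiniteMeasure_withDensity (ne_of_lt ?_)
    calc ∫⁻ h, ENNReal.ofReal (A j i) * ENNReal.ofReal (alg.armDist t h i) ∂(P.map (history R t))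
        ≤ ∫⁻ _, ENNReal.ofReal (A j i) * 1 ∂(P.map (history R t)) := by
          gcongr with h
          refine ENNReal.ofReal_le_one.2 ?_
          rw [← (alg.armDist_mem t h).2]
          exact Finset.single_le_sum (fun i _ => (alg.armDist_mem t h).1 i) (Finset.mem_univ i)
      _ < ⊤ := by simp
  symm
  -- Both factors are finite measures, so agreement on rectangles suffices, and that is the field
  -- `law`.
  refine Measure.prod_eq fun H B hH hB => ?_
  rw [Measure.map_apply (hh.prodMk hm.snd.snd) (hH.prod hB),
    Measure.restrict_apply ((hh.prodMk hm.snd.snd) (hH.prod hB)),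
    withDensity_apply _ hH, lintegral_const_mul _ hd, setLIntegral_map hH hd hh]
  have h1 := hR.law t H hH i j B hB
  rw [show (fun ω => (history R t ω, (R t ω).2.2)) ⁻¹' (H ×ˢ B) ∩
      {ω | (R t ω).1 = i ∧ (R t ω).2.1 = j} =
      {ω | history R t ω ∈ H ∧ (R t ω).1 = i ∧ (R t ω).2.1 = j ∧ (R t ω).2.2 ∈ B} by
    ext ω; simp only [Set.mem_inter_iff, Set.mem_preimage, Set.mem_prod, Set.mem_ofPred_eq]; tauto,
    h1, mul_comm (ENNReal.ofReal (A j i))]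
  rfl

/-- The expectation of a function of the history and of the next round. -/
lemma IsInteraction.lintegral_round [IsProbabilityMeasure P] (hR : IsInteraction P alg μ R)
    (t : ℕ) {G : History n k t × Round n k → ℝ≥0∞} (hG : Measurable G) :
    ∫⁻ ω, G (history R t ω, R t ω) ∂P =
      ∫⁻ ω, ∑ i, ∑ j, ENNReal.ofReal (A j i) * ENNReal.ofReal (alg.armDist t (history R t ω) i) *
        ∫⁻ y, G (history R t ω, i, j, y) ∂gaussianReal (μ j) 1 ∂P := by
  have hh := hR.measurable_history t
  have hm := hR.measurable t
  have hd : ∀ i j, Measurable fun h : History n k t =>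
      ENNReal.ofReal (A j i) * ENNReal.ofReal (alg.armDist t h i) := fun i j =>
    (alg.measurable_armDist_apply t i).ennreal_ofReal.const_mul _
  have hGij : ∀ i j, Measurable fun x : History n k t × ℝ => G (x.1, i, j, x.2) := fun i j =>
    hG.comp (measurable_fst.prodMk
      (measurable_const.prodMk (measurable_const.prodMk measurable_snd)))
  have hgl : ∀ i j, Measurable fun h : History n k t =>
      ∫⁻ y, G (h, i, j, y) ∂gaussianReal (μ j) 1 := fun i j =>
    (hGij i j).lintegral_prod_right'
  have hE : ∀ i j, MeasurableSet {ω | (R t ω).1 = i ∧ (R t ω).2.1 = j} := fun i j =>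
    (hm.fst (measurableSet_singleton i)).inter (hm.snd.fst (measurableSet_singleton j))
  have hGR : Measurable fun ω => G (history R t ω, R t ω) := hG.comp (hh.prodMk hm)
  have hm2 : ∀ i j, Measurable fun ω =>
      ENNReal.ofReal (A j i) * ENNReal.ofReal (alg.armDist t (history R t ω) i) *
        ∫⁻ y, G (history R t ω, i, j, y) ∂gaussianReal (μ j) 1 := fun i j =>
    ((hd i j).comp hh).mul ((hgl i j).comp hh)
  -- The events indexed by the arm and the context partition the space.
  have hsplit : ∀ ω, G (history R t ω, R t ω) = ∑ i, ∑ j,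
      Set.indicator {ω | (R t ω).1 = i ∧ (R t ω).2.1 = j}
        (fun ω => G (history R t ω, R t ω)) ω := by
    intro ω
    rw [Finset.sum_eq_single (R t ω).1 (fun i _ hi => Finset.sum_eq_zero fun j _ =>
      Set.indicator_of_notMem (fun h => hi h.1.symm) _) (by simp),
      Finset.sum_eq_single (R t ω).2.1 (fun j _ hj =>
      Set.indicator_of_notMem (fun h => hj h.2.symm) _) (by simp)]
    have hmem : ω ∈ {ω' | (R t ω').1 = (R t ω).1 ∧ (R t ω').2.1 = (R t ω).2.1} := ⟨rfl, rfl⟩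
    exact (Set.indicator_of_mem hmem fun ω => G (history R t ω, R t ω)).symm
  rw [lintegral_congr hsplit, lintegral_finsetSum _ fun i _ =>
    Finset.measurable_fun_sum _ fun j _ => hGR.indicator (hE i j),
    lintegral_finsetSum _ fun i _ => Finset.measurable_fun_sum _ fun j _ => hm2 i j]
  refine Finset.sum_congr rfl fun i _ => ?_
  rw [lintegral_finsetSum _ fun j _ => hGR.indicator (hE i j),
    lintegral_finsetSum _ fun j _ => hm2 i j]
  refine Finset.sum_congr rfl fun j _ => ?_
  rw [lintegral_indicator (hE i j)]
  calc ∫⁻ ω in {ω | (R t ω).1 = i ∧ (R t ω).2.1 = j}, G (history R t ω, R t ω) ∂P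
      = ∫⁻ ω in {ω | (R t ω).1 = i ∧ (R t ω).2.1 = j},
          G (history R t ω, i, j, (R t ω).2.2) ∂P := by
        refine setLIntegral_congr_fun (hE i j) fun ω hω => ?_
        rw [← hω.1, ← hω.2]
    _ = ∫⁻ x, G (x.1, i, j, x.2) ∂((P.restrict {ω | (R t ω).1 = i ∧ (R t ω).2.1 = j}).map
          (fun ω => (history R t ω, (R t ω).2.2))) :=
        (lintegral_map (hGij i j) (hh.prodMk hm.snd.snd)).symm
    _ = _ := by
        rw [hR.map_restrict t i j, lintegral_prod _ (hGij i j).aemeasurable,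
          lintegral_withDensity_eq_lintegral_mul _ (hd i j) (hgl i j),
          lintegral_map ((hd i j).mul (hgl i j)) hh]
        rfl

/-- Exponential moments of a sum of increments with bounded conditional exponential moments. -/
lemma IsInteraction.lintegral_exp_le [IsProbabilityMeasure P] (hR : IsInteraction P alg μ R)
    {Φ : ∀ t, History n k t → ℝ} (hΦ : ∀ t, Measurable (Φ t)) (h0 : ∀ h, Φ 0 h = 0)
    {D : ∀ t, History n k t × Round n k → ℝ} (hD : ∀ t, Measurable (D t))
    (hstep : ∀ t ω, Φ (t + 1) (history R (t + 1) ω) =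
      Φ t (history R t ω) + D t (history R t ω, R t ω)) {c : ℝ}
    (hc : ∀ t h, ∑ i, ∑ j, ENNReal.ofReal (A j i) * ENNReal.ofReal (alg.armDist t h i) *
      ∫⁻ y, ENNReal.ofReal (Real.exp (D t (h, i, j, y))) ∂gaussianReal (μ j) 1 ≤
        ENNReal.ofReal (Real.exp c)) (t : ℕ) :
    ∫⁻ ω, ENNReal.ofReal (Real.exp (Φ t (history R t ω))) ∂P ≤
      ENNReal.ofReal (Real.exp (c * t)) := by
  induction t with
  | zero => simp [h0]
  | succ t ih =>
    have hexp : ∀ ω, ENNReal.ofReal (Real.exp (Φ (t + 1) (history R (t + 1) ω))) =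
        ENNReal.ofReal (Real.exp (Φ t (history R t ω))) *
          ENNReal.ofReal (Real.exp (D t (history R t ω, R t ω))) := fun ω => by
      rw [hstep, Real.exp_add, ENNReal.ofReal_mul (Real.exp_pos _).le]
    have hDm : Measurable fun x => ENNReal.ofReal (Real.exp (D t x)) :=
      (hD t).exp.ennreal_ofReal
    rw [lintegral_congr hexp, hR.lintegral_round t
      (G := fun x => ENNReal.ofReal (Real.exp (Φ t x.1)) * ENNReal.ofReal (Real.exp (D t x)))
      (((hΦ t).comp measurable_fst).exp.ennreal_ofReal.mul hDm)]
    calc _ ≤ ∫⁻ ω, ENNReal.ofReal (Real.exp (Φ t (history R t ω))) *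
          ENNReal.ofReal (Real.exp c) ∂P := by
          refine lintegral_mono fun ω => ?_
          dsimp only
          refine le_trans (le_of_eq ?_) (mul_le_mul_right (hc t (history R t ω)) _)
          rw [Finset.mul_sum]
          refine Finset.sum_congr rfl fun i _ => ?_
          rw [Finset.mul_sum]
          refine Finset.sum_congr rfl fun j _ => ?_
          have hDy : Measurable fun y =>
              ENNReal.ofReal (Real.exp (D t (history R t ω, i, j, y))) :=
            hDm.comp (measurable_const.prodMk
              (measurable_const.prodMk (measurable_const.prodMk measurable_id)))
          rw [lintegral_const_mul _ hDy]
          ring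
      _ ≤ ENNReal.ofReal (Real.exp (c * t)) * ENNReal.ofReal (Real.exp c) := by
          have hΦω : Measurable fun ω => ENNReal.ofReal (Real.exp (Φ t (history R t ω))) :=
            ((hΦ t).comp (hR.measurable_history t)).exp.ennreal_ofReal
          rw [lintegral_mul_const _ hΦω]
          gcongr
      _ = _ := by
          rw [← ENNReal.ofReal_mul (Real.exp_pos _).le, ← Real.exp_add]
          push_cast
          ring_nf

/-! ### Counts minus compensators, and centred rewards. -/

/-- The sum of the policies played in the first `t` rounds. -/
noncomputable def cumPolicy (alg : SamplingRule A) : (t : ℕ) → History n k t → Fin k → ℝ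
  | 0, _ => 0
  | t + 1, h => cumPolicy alg t (Fin.init h) + A *ᵥ alg.armDist t (Fin.init h)

/-- The sum of the centred rewards observed with context `j`. -/
noncomputable def noiseSum (μ : Fin k → ℝ) (j : Fin k) (t : ℕ) (h : History n k t) : ℝ :=
  ∑ s, if (h s).2.1 = j then (h s).2.2 - μ j else 0

lemma contextCount_eq_sum {t : ℕ} (h : History n k t) (j : Fin k) :
    (contextCount h j : ℝ) = ∑ s, if (h s).2.1 = j then 1 else 0 := by
  rw [contextCount, Finset.sum_boole]

lemma contextCount_history_succ {Ω : Type*} (R : ℕ → Ω → Round n k) (t : ℕ) (ω : Ω) (j : Fin k) :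
    (contextCount (history R (t + 1) ω) j : ℝ) =
      contextCount (history R t ω) j + if (R t ω).2.1 = j then 1 else 0 := by
  rw [contextCount_eq_sum, contextCount_eq_sum, Fin.sum_univ_castSucc]
  rfl

lemma cumPolicy_history_succ {Ω : Type*} (alg : SamplingRule A) (R : ℕ → Ω → Round n k) (t : ℕ) (ω : Ω) :
    cumPolicy alg (t + 1) (history R (t + 1) ω) =
      cumPolicy alg t (history R t ω) + A *ᵥ alg.armDist t (history R t ω) := rfl

lemma measurable_policy (alg : SamplingRule A) (t : ℕ) (j : Fin k) :
    Measurable fun h : History n k t => (A *ᵥ alg.armDist t h) j := by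
  simp only [Matrix.mulVec, dotProduct]
  exact Finset.measurable_fun_sum _ fun i _ => (alg.measurable_armDist_apply t i).const_mul _

lemma measurable_cumPolicy (alg : SamplingRule A) (t : ℕ) (j : Fin k) :
    Measurable fun h : History n k t => cumPolicy alg t h j := by
  induction t with
  | zero => exact measurable_const
  | succ t ih =>
    have hi : Measurable fun h : History n k (t + 1) => (Fin.init h : History n k t) :=
      measurable_pi_lambda _ fun s => measurable_pi_apply _
    exact (ih.comp hi).add ((measurable_policy alg t j).comp hi)

lemma measurable_ite_context {t : ℕ} (s : Fin t) (j : Fin k) {f : History n k t → ℝ}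
    (hf : Measurable f) : Measurable fun h : History n k t => if (h s).2.1 = j then f h else 0 :=
  Measurable.ite ((measurable_pi_apply s).snd.fst (measurableSet_singleton j)) hf measurable_const

lemma measurable_contextCount (t : ℕ) (j : Fin k) :
    Measurable fun h : History n k t => (contextCount h j : ℝ) := by
  simp_rw [contextCount_eq_sum]
  exact Finset.measurable_fun_sum _ fun s _ => measurable_ite_context s j measurable_const

lemma measurable_noiseSum (μ : Fin k → ℝ) (j : Fin k) (t : ℕ) :
    Measurable (noiseSum (n := n) μ j t) :=
  Finset.measurable_fun_sum _ fun s _ =>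
    measurable_ite_context s j ((measurable_pi_apply s).snd.snd.sub_const _)

/-- A bound on a conditional expectation given the history. -/
lemma sum_ofReal_mul_le (hA : IsContextMatrix A) {t : ℕ} {h : History n k t}
    {I : Fin n → Fin k → ℝ≥0∞} {x : Fin k → ℝ} {c : ℝ} (hx : ∀ j, 0 ≤ x j)
    (hI : ∀ i j, I i j ≤ ENNReal.ofReal (x j))
    (hc : ∑ j, (A *ᵥ alg.armDist t h) j * x j ≤ c) :
    ∑ i, ∑ j, ENNReal.ofReal (A j i) * ENNReal.ofReal (alg.armDist t h i) * I i j ≤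
      ENNReal.ofReal c := by
  have hp := (alg.armDist_mem t h).1
  calc _ ≤ ∑ i, ∑ j, ENNReal.ofReal (A j i * alg.armDist t h i * x j) := by
        refine Finset.sum_le_sum fun i _ => Finset.sum_le_sum fun j _ => ?_
        rw [ENNReal.ofReal_mul (mul_nonneg (hA.pos j i).le (hp i)),
          ENNReal.ofReal_mul (hA.pos j i).le]
        gcongr
        exact hI i j
    _ = ENNReal.ofReal (∑ i, ∑ j, A j i * alg.armDist t h i * x j) := by
        have h0 : ∀ i j, 0 ≤ A j i * alg.armDist t h i * x j := fun i j =>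
          mul_nonneg (mul_nonneg (hA.pos j i).le (hp i)) (hx j)
        rw [ENNReal.ofReal_sum_of_nonneg fun i _ => Finset.sum_nonneg fun j _ => h0 i j]
        exact Finset.sum_congr rfl fun i _ =>
          (ENNReal.ofReal_sum_of_nonneg fun j _ => h0 i j).symm
    _ ≤ ENNReal.ofReal c := by
        refine ENNReal.ofReal_le_ofReal (le_trans (le_of_eq ?_) hc)
        rw [Finset.sum_comm]
        refine Finset.sum_congr rfl fun j _ => ?_
        rw [Matrix.mulVec, dotProduct, Finset.sum_mul]

lemma sum_policy (hA : IsContextMatrix A) {p : Fin n → ℝ} (hp : p ∈ stdSimplex ℝ (Fin n)) :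
    ∑ j, (A *ᵥ p) j = 1 := by
  simp only [Matrix.mulVec, dotProduct]
  rw [Finset.sum_comm]
  simp_rw [← Finset.sum_mul, hA.sum_eq_one, one_mul]
  exact hp.2

lemma policy_nonneg (hA : IsContextMatrix A) {p : Fin n → ℝ} (hp : p ∈ stdSimplex ℝ (Fin n))
    (j : Fin k) : 0 ≤ (A *ᵥ p) j := by
  simp only [Matrix.mulVec, dotProduct]
  exact Finset.sum_nonneg fun i _ => mul_nonneg (hA.pos j i).le (hp.1 i)

lemma lintegral_exp_count_le [IsProbabilityMeasure P] (hA : IsContextMatrix A)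
    (hR : IsInteraction P alg μ R) {l : ℝ} (hl : |l| ≤ 1) (j : Fin k) (t : ℕ) :
    ∫⁻ ω, ENNReal.ofReal (Real.exp
      (l * (contextCount (history R t ω) j - cumPolicy alg t (history R t ω) j))) ∂P ≤
      ENNReal.ofReal (Real.exp (l ^ 2 * t)) := by
  refine hR.lintegral_exp_le
    (Φ := fun t h => l * (contextCount h j - cumPolicy alg t h j))
    (D := fun t x => l * ((if x.2.2.1 = j then 1 else 0) - (A *ᵥ alg.armDist t x.1) j))
    (fun t => ((measurable_contextCount t j).sub (measurable_cumPolicy alg t j)).const_mul _)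
    (fun h => by simp [contextCount, cumPolicy])
    (fun t => ((Measurable.ite (measurable_snd.snd.fst (measurableSet_singleton j))
      measurable_const measurable_const).sub
        ((measurable_policy alg t j).comp measurable_fst)).const_mul _)
    (fun t ω => ?_) (fun t h => ?_) t
  · rw [contextCount_history_succ, cumPolicy_history_succ, Pi.add_apply]
    ring
  · have hm := alg.armDist_mem t h
    set p := A *ᵥ alg.armDist t h with hp
    have hp0 : ∀ j, 0 ≤ p j := policy_nonneg hA hm
    have hp1 : p j ≤ 1 := by
      rw [← sum_policy hA hm]
      exact Finset.single_le_sum (fun j _ => hp0 j) (Finset.mem_univ j)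
    refine sum_ofReal_mul_le hA
      (x := fun j' => Real.exp (l * ((if j' = j then 1 else 0) - p j)))
      (fun _ => (Real.exp_pos _).le) (fun i j' => by
        change ∫⁻ _, ENNReal.ofReal (Real.exp (l * ((if j' = j then 1 else 0) - p j)))
          ∂gaussianReal (μ j') 1 ≤ _
        rw [lintegral_const, measure_univ, mul_one]) ?_
    -- From `e^x ≤ 1 + x + x²` for `|x| ≤ 1`. The linear term is kept because it averages to zero:
    -- context `j` has conditional probability `p j`.
    have hb : ∀ j', Real.exp (l * ((if j' = j then 1 else 0) - p j)) ≤
        1 + l ^ 2 - l * p j + l * (if j' = j then 1 else 0) := by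
      intro j'
      set z : ℝ := (if j' = j then 1 else 0) - p j with hz
      have hz1 : |z| ≤ 1 := by
        have := hp0 j
        rw [hz, abs_le]
        split_ifs <;> constructor <;> linarith
      have hlz : |l * z| ≤ 1 := by
        rw [abs_mul]
        exact mul_le_one₀ hl (abs_nonneg _) hz1
      have h1 := (abs_le.1 (Real.abs_exp_sub_one_sub_id_le hlz)).2
      have h2 : (l * z) ^ 2 ≤ l ^ 2 := by
        rw [mul_pow]
        exact mul_le_of_le_one_right (sq_nonneg _) ((sq_le_one_iff_abs_le_one z).2 hz1)
      have h3 : l * z = l * (if j' = j then 1 else 0) - l * p j := by rw [hz]; ring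
      linarith
    calc ∑ j', p j' * Real.exp (l * ((if j' = j then 1 else 0) - p j))
        ≤ ∑ j', p j' * (1 + l ^ 2 - l * p j + l * (if j' = j then 1 else 0)) :=
          Finset.sum_le_sum fun j' _ => mul_le_mul_of_nonneg_left (hb j') (hp0 j')
      _ = (∑ j', p j') * (1 + l ^ 2 - l * p j) + l * p j := by
          simp_rw [mul_add, Finset.sum_add_distrib, Finset.sum_mul]
          congr 1
          simp [mul_comm]
      _ = l ^ 2 + 1 := by
          rw [hp, sum_policy hA hm]; ring
      _ ≤ Real.exp (l ^ 2) := Real.add_one_le_exp _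

lemma lintegral_exp_gaussianReal (m l : ℝ) :
    ∫⁻ y, ENNReal.ofReal (Real.exp (l * (y - m))) ∂gaussianReal m 1 =
      ENNReal.ofReal (Real.exp (l ^ 2 / 2)) := by
  have h : ∀ y, Real.exp (l * (y - m)) = Real.exp (-(l * m)) * Real.exp (l * y) := fun y => by
    rw [← Real.exp_add]; ring_nf
  simp_rw [h]
  rw [← ofReal_integral_eq_lintegral_ofReal ((integrable_exp_mul_gaussianReal l).const_mul _)
    (ae_of_all _ fun _ => by positivity), integral_const_mul]
  have h2 := congrFun (mgf_id_gaussianReal (μ := m) (v := 1)) l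
  rw [mgf] at h2
  simp only [id_eq] at h2
  rw [h2, ← Real.exp_add]
  congr 2
  push_cast
  ring

lemma lintegral_exp_noise_le [IsProbabilityMeasure P] (hA : IsContextMatrix A)
    (hR : IsInteraction P alg μ R) (l : ℝ) (j : Fin k) (t : ℕ) :
    ∫⁻ ω, ENNReal.ofReal (Real.exp (l * noiseSum μ j t (history R t ω))) ∂P ≤
      ENNReal.ofReal (Real.exp (l ^ 2 * t)) := by
  refine hR.lintegral_exp_le
    (Φ := fun t h => l * noiseSum μ j t h)
    (D := fun t x => l * (if x.2.2.1 = j then x.2.2.2 - μ j else 0))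
    (fun t => (measurable_noiseSum μ j t).const_mul _)
    (fun h => by simp [noiseSum])
    (fun t => (Measurable.ite (measurable_snd.snd.fst (measurableSet_singleton j))
      (measurable_snd.snd.snd.sub_const _) measurable_const).const_mul _)
    (fun t ω => ?_) (fun t h => ?_) t
  · rw [noiseSum, noiseSum, Fin.sum_univ_castSucc, mul_add]
    rfl
  · refine sum_ofReal_mul_le hA (x := fun _ => Real.exp (l ^ 2))
      (fun _ => (Real.exp_pos _).le) (fun i j' => ?_) ?_
    · by_cases hj : j' = j
      · subst hj
        simp only [if_true]
        rw [lintegral_exp_gaussianReal]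
        -- The Gaussian exponent `l² / 2` is weakened to `l²` so that one Chernoff bound serves both
        -- kinds of sums.
        exact ENNReal.ofReal_le_ofReal (Real.exp_le_exp.2 (by nlinarith [sq_nonneg l]))
      · simp only [if_neg hj, mul_zero, Real.exp_zero, lintegral_const, measure_univ, mul_one]
        exact ENNReal.ofReal_le_ofReal (Real.one_le_exp (sq_nonneg _))
    · rw [← Finset.sum_mul, sum_policy hA (alg.armDist_mem t h), one_mul]

/-! ### Concentration and the last deviation time. -/

/-- A Chernoff bound. -/
lemma measure_abs_ge_le {X : Ω → ℝ} (hX : Measurable X) {ε : ℝ} (hε0 : 0 < ε) (hε : ε ≤ 1)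
    {t : ℕ} (h : ∀ l : ℝ, |l| ≤ 1 →
      ∫⁻ ω, ENNReal.ofReal (Real.exp (l * X ω)) ∂P ≤ ENNReal.ofReal (Real.exp (l ^ 2 * t))) :
    P {ω | ε * t < |X ω|} ≤ 2 * ENNReal.ofReal (Real.exp (-(ε ^ 2 / 4)) ^ t) := by
  have key : ∀ l : ℝ, |l| ≤ 1 → l ^ 2 = ε ^ 2 / 4 → P {ω | ε ^ 2 / 2 * t ≤ l * X ω} ≤
      ENNReal.ofReal (Real.exp (-(ε ^ 2 / 4)) ^ t) := by
    intro l hl hl2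
    have h1 := mul_meas_ge_le_lintegral (μ := P) ((hX.const_mul l).exp.ennreal_ofReal)
      (ENNReal.ofReal (Real.exp (ε ^ 2 / 2 * t)))
    have h2 := h1.trans (h l hl)
    rw [mul_comm, ← ENNReal.le_div_iff_mul_le
      (Or.inl (ENNReal.ofReal_pos.2 (Real.exp_pos _)).ne') (Or.inl ENNReal.ofReal_ne_top),
      ← ENNReal.ofReal_div_of_pos (Real.exp_pos _), ← Real.exp_sub] at h2
    rw [← Real.exp_nat_mul]
    refine le_trans (measure_mono fun ω hω => ?_) (h2.trans (le_of_eq ?_))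
    · exact ENNReal.ofReal_le_ofReal (Real.exp_le_exp.2 hω)
    · rw [hl2]; ring_nf
  -- The choice `l = ±ε / 2` minimizes `l² - |l| ε`, with value `-ε² / 4`.
  have hl : |ε / 2| ≤ 1 := by rw [abs_of_pos (by positivity)]; linarith
  calc P {ω | ε * t < |X ω|}
      ≤ P ({ω | ε ^ 2 / 2 * t ≤ ε / 2 * X ω} ∪ {ω | ε ^ 2 / 2 * t ≤ -(ε / 2) * X ω}) := by
        refine measure_mono fun ω hω => ?_
        have hω' : ε * t < |X ω| := hω
        rcases lt_abs.1 hω' with h | h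
        · left
          show ε ^ 2 / 2 * t ≤ ε / 2 * X ω
          nlinarith
        · right
          show ε ^ 2 / 2 * t ≤ -(ε / 2) * X ω
          nlinarith
    _ ≤ _ := by
        refine (measure_union_le _ _).trans ?_
        rw [two_mul]
        exact add_le_add (key _ hl (by ring)) (key _ (by rwa [abs_neg]) (by ring))

/-- The event that after `t` rounds some context count is far from its compensator, or some
centred sum of rewards is large. -/
def deviationEvent (alg : SamplingRule A) (μ : Fin k → ℝ) (R : ℕ → Ω → Round n k) (ε : ℝ)
    (t : ℕ) : Set Ω :=
  ⋃ j, ({ω | ε * t < |contextCount (history R t ω) j - cumPolicy alg t (history R t ω) j|} ∪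
    {ω | ε * t < |noiseSum μ j t (history R t ω)|})

lemma measurableSet_deviationEvent (hR : IsInteraction P alg μ R) (ε : ℝ) (t : ℕ) :
    MeasurableSet (deviationEvent alg μ R ε t) := by
  have hh := hR.measurable_history t
  refine MeasurableSet.iUnion fun j => MeasurableSet.union ?_ ?_
  · exact measurableSet_lt measurable_const
      (((measurable_contextCount t j).sub (measurable_cumPolicy alg t j)).comp hh).abs
  · exact measurableSet_lt measurable_const ((measurable_noiseSum μ j t).comp hh).abs

lemma measure_deviationEvent_le [IsProbabilityMeasure P] (hA : IsContextMatrix A)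
    (hR : IsInteraction P alg μ R) {ε : ℝ} (hε0 : 0 < ε) (hε : ε ≤ 1) (t : ℕ) :
    P (deviationEvent alg μ R ε t) ≤ 4 * k * ENNReal.ofReal (Real.exp (-(ε ^ 2 / 4)) ^ t) := by
  have hh := hR.measurable_history t
  refine (measure_iUnion_fintype_le _ _).trans ?_
  have : ∀ j ∈ Finset.univ,
      P ({ω | ε * t < |contextCount (history R t ω) j - cumPolicy alg t (history R t ω) j|} ∪
        {ω | ε * t < |noiseSum μ j t (history R t ω)|}) ≤
      4 * ENNReal.ofReal (Real.exp (-(ε ^ 2 / 4)) ^ t) := fun j _ => by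
    refine (measure_union_le _ _).trans ((add_le_add
      (measure_abs_ge_le
        (((measurable_contextCount t j).sub (measurable_cumPolicy alg t j)).comp hh) hε0 hε
        fun l hl => lintegral_exp_count_le hA hR hl j t)
      (measure_abs_ge_le ((measurable_noiseSum μ j t).comp hh) hε0 hε
        fun l _ => lintegral_exp_noise_le hA hR l j t)).trans (le_of_eq ?_))
    rw [← add_mul]; norm_num
  refine (Finset.sum_le_sum this).trans (le_of_eq ?_)
  rw [Finset.sum_const, Finset.card_univ, Fintype.card_fin, nsmul_eq_mul]
  ring

/-- A random time after which no deviation occurs. -/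
noncomputable def deviationTime (alg : SamplingRule A) (μ : Fin k → ℝ) (R : ℕ → Ω → Round n k)
    (ε : ℝ) (ω : Ω) : ℝ≥0∞ :=
  ∑' t : ℕ, (deviationEvent alg μ R ε t).indicator (fun _ => (t : ℝ≥0∞)) ω

lemma lintegral_deviationTime_lt_top [IsProbabilityMeasure P] (hA : IsContextMatrix A)
    (hR : IsInteraction P alg μ R) {ε : ℝ} (hε0 : 0 < ε) (hε : ε ≤ 1) :
    ∫⁻ ω, deviationTime alg μ R ε ω ∂P < ⊤ := by
  have hr : Real.exp (-(ε ^ 2 / 4)) < 1 := Real.exp_lt_one_iff.2 (neg_lt_zero.2 (by positivity))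
  have hs : Summable fun t : ℕ => (t : ℝ) ^ 1 * Real.exp (-(ε ^ 2 / 4)) ^ t :=
    summable_pow_mul_geometric_of_norm_lt_one 1
      (by rwa [Real.norm_eq_abs, abs_of_pos (Real.exp_pos _)])
  unfold deviationTime
  rw [lintegral_tsum fun t =>
    (measurable_const.indicator (measurableSet_deviationEvent hR ε t)).aemeasurable]
  calc ∑' t : ℕ, ∫⁻ ω, (deviationEvent alg μ R ε t).indicator (fun _ => (t : ℝ≥0∞)) ω ∂P
      ≤ ∑' t : ℕ, 4 * k * ENNReal.ofReal ((t : ℝ) ^ 1 * Real.exp (-(ε ^ 2 / 4)) ^ t) := by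
        refine ENNReal.tsum_le_tsum fun t => ?_
        rw [lintegral_indicator_const (measurableSet_deviationEvent hR ε t), pow_one,
          ENNReal.ofReal_mul (Nat.cast_nonneg _), ENNReal.ofReal_natCast, mul_left_comm]
        gcongr
        exact measure_deviationEvent_le hA hR hε0 hε t
    _ < ⊤ := by
        rw [ENNReal.tsum_mul_left, ← ENNReal.ofReal_tsum_of_nonneg (fun t => by positivity) hs]
        exact ENNReal.mul_lt_top (ENNReal.mul_lt_top (by simp) (by simp)) ENNReal.ofReal_lt_top

/-- A deviation at time `t` alone contributes `t` to the sum defining `deviationTime`. -/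
lemma notMem_deviationEvent {Ω : Type*} {R : ℕ → Ω → Round n k} {ε : ℝ} {ω : Ω} {t : ℕ} (h : deviationTime alg μ R ε ω < t) :
    ω ∉ deviationEvent alg μ R ε t := by
  intro hω
  have h1 := ENNReal.le_tsum (f := fun t : ℕ =>
    (deviationEvent alg μ R ε t).indicator (fun _ => (t : ℝ≥0∞)) ω) t
  rw [Set.indicator_of_mem hω] at h1
  exact absurd h (not_lt.2 h1)

end SeparatorBandit

/-! ### Pathwise analysis without deviations. -/

namespace SeparatorBandit

variable {n k : ℕ}
variable {A : Matrix (Fin k) (Fin n) ℝ} {μ : Fin k → ℝ} {b : Fin n} {alg : SamplingRule A}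

lemma cumPolicy_mem_Icc {a : ℝ} (hA : ∀ j i, A j i ∈ Set.Icc a 1) (alg : SamplingRule A)
    (j : Fin k) : ∀ (t : ℕ) (h : History n k t), cumPolicy alg t h j ∈ Set.Icc (a * t) t
  | 0, h => by simp [cumPolicy]
  | t + 1, h => by
    have h1 := cumPolicy_mem_Icc hA alg j t (Fin.init h)
    have h2 := bounds_of_mem_policySpace hA
      (mulVec_mem_policySpace A (alg.armDist_mem t (Fin.init h))) j
    rw [Set.mem_Icc] at *
    rw [cumPolicy, Pi.add_apply]
    push_cast
    constructor <;> linarith [h1.1, h1.2, h2.1, h2.2]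

lemma empMean_sub {t : ℕ} {h : History n k t} (hI : InitDone h) (μ : Fin k → ℝ) (j : Fin k) :
    empMean h j - μ j = noiseSum μ j t h / contextCount h j := by
  have hN : (contextCount h j : ℝ) ≠ 0 := by exact_mod_cast (hI j).ne'
  have hc : (contextCount h j : ℝ) * μ j =
      ∑ s ∈ Finset.univ.filter (fun s : Fin t => (h s).2.1 = j), μ j := by
    rw [Finset.sum_const, nsmul_eq_mul, contextCount]
  rw [empMean, noiseSum, ← Finset.sum_filter, Finset.sum_sub_distrib, ← hc]
  field_simp

lemma contextFreq_mem_Icc {t : ℕ} (h : History n k t) (j : Fin k) :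
    contextFreq h j ∈ Set.Icc (0 : ℝ) 1 := by
  have : (contextCount h j : ℝ) ≤ t := by exact_mod_cast contextCount_le h j
  exact ⟨by unfold contextFreq; positivity, div_le_one_of_le₀ this (Nat.cast_nonneg _)⟩

/-- Without deviation, all contexts are observed linearly often, and the empirical quantities are
close to their targets. -/
lemma of_notMem_deviationEvent {Ω : Type*} {R : ℕ → Ω → Round n k} {ω : Ω} {a ε : ℝ}
    (hA : ∀ j i, A j i ∈ Set.Icc a 1) (hε0 : 0 < ε) (hεa : ε ≤ a / 2) {t : ℕ} (ht : 0 < t)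
    (hω : ω ∉ deviationEvent alg μ R ε t) :
    InitDone (history R t ω) ∧ (∀ j, |empMean (history R t ω) j - μ j| ≤ 2 * ε / a) ∧
      ∀ j, |contextFreq (history R t ω) j - cumPolicy alg t (history R t ω) j / t| ≤ ε := by
  have ht' : (0 : ℝ) < t := by exact_mod_cast ht
  have hdev : ∀ j, |contextCount (history R t ω) j - cumPolicy alg t (history R t ω) j| ≤ ε * t ∧
      |noiseSum μ j t (history R t ω)| ≤ ε * t := by
    intro j
    by_contra hcon
    refine hω (Set.mem_iUnion.2 ⟨j, ?_⟩)
    rcases not_and_or.1 hcon with h | h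
    · exact Or.inl (not_le.1 h)
    · exact Or.inr (not_le.1 h)
  have hN : ∀ j, a / 2 * t ≤ contextCount (history R t ω) j := fun j => by
    have h1 := (abs_le.1 (hdev j).1).1
    have h2 := (cumPolicy_mem_Icc hA alg j t (history R t ω)).1
    nlinarith
  have ha : 0 < a := by linarith
  have hI : InitDone (history R t ω) := fun j => by
    have : (0 : ℝ) < contextCount (history R t ω) j := lt_of_lt_of_le (by positivity) (hN j)
    exact_mod_cast this
  refine ⟨hI, fun j => ?_, fun j => ?_⟩
  · rw [empMean_sub hI, abs_div, Nat.abs_cast]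
    calc |noiseSum μ j t (history R t ω)| / contextCount (history R t ω) j
        ≤ (ε * t) / (a / 2 * t) := by
          gcongr
          · exact (hdev j).2
          · exact hN j
      _ = 2 * ε / a := by field_simp
  · rw [contextFreq, ← sub_div, abs_div, Nat.abs_cast, div_le_iff₀ ht']
    exact (hdev j).1

/-- After a time without deviations, the best arm is identified and the complexity of the observed
context frequencies is almost at most that of any other point of the policy space. -/
theorem exists_complexity_contextFreq_le {a : ℝ} (ha : 0 < a) (hA : ∀ j i, A j i ∈ Set.Icc a 1)
    (hb : IsBestArm A μ b) (alg : SamplingRule A) {w₀ : Fin k → ℝ} (hw₀ : w₀ ∈ policySpace A)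
    {q : ℝ} (hq0 : 0 < q) (hq1 : q < 1) :
    ∃ ε : ℝ, 0 < ε ∧ ε ≤ 1 ∧ ∃ t₁ : ℕ, 0 < t₁ ∧ ∀ {Ω : Type*} (R : ℕ → Ω → Round n k) (ω : Ω)
      (t₀ : ℕ), t₁ ≤ t₀ → (∀ t, t₀ ≤ t → ω ∉ deviationEvent alg μ R ε t) → ∀ t, t₀ ≤ t →
      InitDone (history R t ω) ∧ IsBestArm A (empMean (history R t ω)) b ∧
      t * (q ^ 2 * complexity A (empMean (history R t ω)) b (contextFreq (history R t ω))) ≤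
        t * (complexity A μ b w₀ / q ^ 3) + t₀ * complexity A μ b fun _ => a := by
  obtain ⟨ξ, hξ, hnear⟩ := exists_radius hb hq0 hq1
  set η := (1 - q) * a / 3 with hηdef
  have hη0 : 0 < η := by
    have : 0 < 1 - q := by linarith
    positivity
  -- The bounds serve, in order: frequencies within `η` of `U`, the Chernoff bound, counts at least
  -- `a t / 2`, and empirical means within `ξ` of `μ`.
  obtain ⟨ε, hε0, hε⟩ : ∃ ε : ℝ, 0 < ε ∧ ε ≤ min (min η 1) (min (a / 2) (ξ * a / 4)) :=
    ⟨_, by positivity, le_rfl⟩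
  simp only [le_min_iff] at hε
  obtain ⟨⟨hεη, hε1⟩, hεa, hεξ⟩ := hε
  obtain ⟨t₁, ht₁⟩ := exists_nat_one_div_lt hη0
  refine ⟨ε, hε0, hε1, t₁ + 1, by omega, fun {Ω} R ω t₀ ht₀ hgood t ht => ?_⟩
  have hpol : ∀ {w}, w ∈ policySpace A → ∀ j, w j ∈ Set.Icc a 1 :=
    fun hw => bounds_of_mem_policySpace hA hw
  set C₀ := complexity A μ b w₀
  have hC₀ : 0 ≤ C₀ := complexity_nonneg _ _ _ _
  set U : ℕ → Fin k → ℝ := fun t j => cumPolicy alg t (history R t ω) j / t with hU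
  have hround : ∀ t, t₀ ≤ t → InitDone (history R t ω) ∧ IsBestArm A (empMean (history R t ω)) b ∧
      (∀ w : Fin k → ℝ, (∀ j, 0 < w j) →
        q * complexity A (empMean (history R t ω)) b w ≤ complexity A μ b w ∧
        q * complexity A μ b w ≤ complexity A (empMean (history R t ω)) b w) ∧
      (∀ j, |contextFreq (history R t ω) j - U t j| ≤ η) ∧ ∀ j, U t j ∈ Set.Icc a 1 := by
    intro t ht
    have ht0 : 0 < t := by omega
    have ht' : (0 : ℝ) < t := by exact_mod_cast ht0
    obtain ⟨h1, h2, h3⟩ := of_notMem_deviationEvent hA hε0 hεa ht0 (hgood t ht)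
    obtain ⟨h4, h5⟩ := hnear _ fun j => (h2 j).trans_lt (by
      rw [div_lt_iff₀ ha]
      nlinarith)
    refine ⟨h1, h4, h5, fun j => (h3 j).trans hεη, fun j => ?_⟩
    have h6 := cumPolicy_mem_Icc hA alg j t (history R t ω)
    exact ⟨(le_div_iff₀ ht').2 h6.1, (div_le_one ht').2 h6.2⟩
  -- The potential `t · excess` does not increase, since the excess contracts by `1 - 1/(t+1) =
  -- t/(t+1)`.
  have hpot : ∀ t, t₀ ≤ t → t * max (complexity A μ b (U t) - C₀ / q ^ 3) 0 ≤
      t₀ * complexity A μ b fun _ => a := by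
    intro t ht
    induction t, ht using Nat.le_induction with
    | base =>
      gcongr
      refine max_le ?_ (complexity_nonneg _ _ _ _)
      obtain ⟨-, -, -, -, hu⟩ := hround t₀ le_rfl
      have h1 := mul_complexity_le_of_freq (A := A) (μ := μ) (b := b) (u := fun _ => a)
        (w := U t₀) one_pos (fun _ => ha) fun j => by rw [one_mul]; exact (hu j).1
      have h2 : 0 ≤ C₀ / q ^ 3 := by positivity
      linarith
    | succ t ht ih =>
      obtain ⟨hI, hbt, hcl, hvu, hu⟩ := hround t ht
      have ht' : (0 : ℝ) < t := by
        have : 0 < t := by omega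
        exact_mod_cast this
      obtain ⟨w, ⟨hwP, hwopt⟩, htrack⟩ := alg.tracking t (history R t ω) hI ⟨b, hbt⟩
      have hw := hpol hwP
      have hw0 : ∀ j, 0 < w j := fun j => ha.trans_le (hw j).1
      have hw₀0 : ∀ j, 0 < w₀ j := fun j => ha.trans_le (hpol hw₀ j).1
      have hopt : complexity A (empMean (history R t ω)) b w ≤
          complexity A (empMean (history R t ω)) b w₀ := by
        have h1 := ENNReal.inv_le_inv.2 (hwopt w₀ hw₀)
        rw [inv_objective hbt hw0, inv_objective hbt hw₀0, ENNReal.ofReal_le_ofReal_iff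
          (mul_nonneg two_pos.le (complexity_nonneg _ _ _ _))] at h1
        linarith
      -- Optimality of `w` holds for the empirical means; passing to them and back costs `1 / q²`.
      -- The third factor is the margin required by `complexity_step`.
      have hwc : complexity A μ b w ≤ q * (C₀ / q ^ 3) := by
        have h1 := (hcl w hw0).2
        have h2 := (hcl w₀ hw₀0).1
        have h3 : q * (q * complexity A μ b w) ≤ C₀ := by nlinarith
        have h4 : q * (C₀ / q ^ 3) = C₀ / q ^ 2 := by field_simp
        rw [h4, le_div_iff₀ (by positivity)]
        linarith
      have hp := hpol (mulVec_mem_policySpace A (alg.armDist_mem t (history R t ω)))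
      have hθ : (1 : ℝ) / (t + 1) ≤ η := by
        refine le_trans ?_ ht₁.le
        have : (t₁ : ℝ) ≤ t := by exact_mod_cast (by omega : t₁ ≤ t)
        gcongr
      have hstep := complexity_step (A := A) (μ := μ) (b := b) (θ := 1 / (t + 1 : ℝ))
        (p := A *ᵥ alg.armDist t (history R t ω)) (a := a)
        hq0 hη0 (by rw [hηdef]; linarith) (by positivity)
        ((div_le_one (by positivity)).2 (by linarith)) hθ hu (contextFreq_mem_Icc (history R t ω))
        (fun j => ⟨ha.le.trans (hp j).1, (hp j).2⟩) ha (fun j => (hw j).1) hvu hwc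
        (fun h => by
          obtain ⟨s, hs, hps, -⟩ := htrack h
          exact ⟨s, hs, hps⟩)
      have hUs : U (t + 1) = fun j => U t j + 1 / (t + 1 : ℝ) *
          ((A *ᵥ alg.armDist t (history R t ω)) j - U t j) := by
        ext j
        simp only [hU]
        rw [cumPolicy_history_succ, Pi.add_apply]
        push_cast
        field_simp
        ring
      rw [← hUs] at hstep
      have h1 : max (complexity A μ b (U (t + 1)) - C₀ / q ^ 3) 0 ≤
          (1 - 1 / (t + 1 : ℝ)) * max (complexity A μ b (U t) - C₀ / q ^ 3) 0 := by
        refine max_le hstep (mul_nonneg ?_ (le_max_right _ _))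
        rw [sub_nonneg, div_le_one (by positivity)]
        linarith
      refine le_trans (mul_le_mul_of_nonneg_left h1 (Nat.cast_nonneg _)) (le_trans (le_of_eq ?_) ih)
      push_cast
      field_simp
      ring
  obtain ⟨hI, hbt, hcl, hvu, hu⟩ := hround t ht
  refine ⟨hI, hbt, ?_⟩
  have hu0 : ∀ j, 0 < U t j := fun j => ha.trans_le (hu j).1
  -- Of the factor `q²` in the conclusion, one `q` replaces `U t` by the observed frequencies and
  -- the other `μ` by the empirical means.
  have h1 := mul_complexity_le_of_freq (A := A) (μ := empMean (history R t ω)) (b := b) hq0 hu0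
    (w := contextFreq (history R t ω)) fun j => by
      have h2 := abs_le.1 (hvu j)
      have h3 := (hu j).1
      have h4 : 0 < 1 - q := by linarith
      rw [hηdef] at h2
      nlinarith
  have h2 := (hcl _ hu0).1
  have h3 : q ^ 2 * complexity A (empMean (history R t ω)) b (contextFreq (history R t ω)) ≤
      complexity A μ b (U t) := by nlinarith
  have h4 := hpot t ht
  have h5 := le_max_left (complexity A μ b (U t) - C₀ / q ^ 3) 0
  have h6 : (0 : ℝ) ≤ t := Nat.cast_nonneg _
  nlinarith

end SeparatorBandit

/-! ### Expected stopping time at fixed slack. -/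

namespace SeparatorBandit

variable {n k : ℕ}
variable {A : Matrix (Fin k) (Fin n) ℝ} {μ : Fin k → ℝ} {b : Fin n} {alg : SamplingRule A}
  {Ω : Type*} [MeasurableSpace Ω] {P : Measure Ω} {R : ℕ → Ω → Round n k}

lemma IsContextMatrix.pos_of_arm (hA : IsContextMatrix A) (b : Fin n) : 0 < k := by
  rcases Nat.eq_zero_or_pos k with rfl | h
  · simpa using hA.sum_eq_one b
  · exact h

/-- Logarithmic growth in `t` is absorbed by an arbitrarily small slope, at the cost of a constant
independent of `δ`. -/
lemma exists_threshold_le (n : ℕ) (hk : 0 < k) {q : ℝ} (hq : q ∈ Set.Ioo (1 / 2 : ℝ) 1) :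
    ∃ C : ℝ, 0 ≤ C ∧ ∀ (t : ℕ) (h : History n k t) (δ : ℝ), InitDone h → 0 < t →
      0 ≤ Real.log (1 / δ) → threshold h δ ≤ (1 - q) * t + C + Real.log (1 / δ) / q := by
  have hk' : (0 : ℝ) < k := by exact_mod_cast hk
  have hq0 : 0 < q := lt_trans (by norm_num) hq.1
  have hq1 : 0 < 1 - q := sub_pos.2 hq.2
  -- Chosen so that `ln (s t) ≤ s t - 1`, multiplied by `2k`, produces the slope `1 - q`.
  set s := (1 - q) / (2 * k) with hs
  have hs0 : 0 < s := by positivity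
  refine ⟨|2 * k * (2 - Real.log s) + k * |gFun q| / q|, abs_nonneg _,
    fun t h δ hI ht hδ => (threshold_le hI hk hq hδ).trans ?_⟩
  have ht' : (0 : ℝ) < t := by exact_mod_cast ht
  have h1 := Real.log_le_sub_one_of_pos (mul_pos hs0 ht')
  rw [Real.log_mul hs0.ne' ht'.ne'] at h1
  have h2 : 2 * k * (s * t) = (1 - q) * t := by rw [hs]; field_simp
  have h3 : 2 * k * Real.log t ≤ 2 * k * (s * t - 1 - Real.log s) := by
    gcongr; linarith
  have h4 := le_abs_self (2 * k * (2 - Real.log s) + k * |gFun q| / q)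
  rw [add_div]
  nlinarith

/-- A bound on the expected stopping time for each slack parameter `q < 1`. -/
theorem exists_lintegral_stoppingTime_le [IsProbabilityMeasure P] (hA : IsContextMatrix A)
    (hb : IsBestArm A μ b) (hR : IsInteraction P alg μ R) {w₀ : Fin k → ℝ}
    (hw₀ : w₀ ∈ policySpace A) {q B : ℝ} (hq : q ∈ Set.Ioo (1 / 2 : ℝ) 1)
    (hB : B = (complexity A μ b w₀ / q ^ 3 + (1 - q)) / q ^ 2) (hB1 : 2 * B * (1 - q) < 1) :
    ∃ E : ℝ≥0∞, E ≠ ⊤ ∧ ∀ δ : ℝ, 0 ≤ Real.log (1 / δ) →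
      ∫⁻ ω, (stoppingTime A R δ ω : ℝ≥0∞) ∂P ≤
        E + ENNReal.ofReal (2 * B / (q * (1 - 2 * B * (1 - q))) * Real.log (1 / δ)) := by
  have hq0 : 0 < q := lt_trans (by norm_num) hq.1
  have hq1 : 0 < 1 - q := sub_pos.2 hq.2
  obtain ⟨a, ha, hbd⟩ := hA.exists_bounds
  obtain ⟨ε, hε0, hε1, t₁, ht₁, hpath⟩ :=
    exists_complexity_contextFreq_le ha hbd hb alg hw₀ hq0 hq.2
  obtain ⟨C, hC0, hC⟩ := exists_threshold_le n (hA.pos_of_arm b) hq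
  set K := complexity A μ b fun _ => a
  have hC₀ : 0 ≤ complexity A μ b w₀ := complexity_nonneg _ _ _ _
  have hB0 : 0 < B := by rw [hB]; positivity
  set r := 1 - 2 * B * (1 - q) with hr
  have hr0 : 0 < r := by rw [hr]; linarith
  -- For `t ≥ m t₀` the initial excess `t₀ K` is at most `t (1 - q)`; the summand `1` ensures `t ≥
  -- t₀`.
  set m : ℕ := 1 + ⌈K / (1 - q)⌉₊ with hm
  have hσ := lintegral_deviationTime_lt_top hA hR hε0 hε1
  refine ⟨m * (∫⁻ ω, deviationTime alg μ R ε ω ∂P + (1 + t₁)) + ENNReal.ofReal (2 * B * C / r) + 2,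
    ?_, fun δ hδ => ?_⟩
  · have : ∫⁻ ω, deviationTime alg μ R ε ω ∂P + (1 + t₁) ≠ ⊤ := by
      simp [hσ.ne]
    have := ENNReal.mul_ne_top (ENNReal.natCast_ne_top m) this
    finiteness
  set L := Real.log (1 / δ)
  have hpt : ∀ ω, (stoppingTime A R δ ω : ℝ≥0∞) ≤ m * (deviationTime alg μ R ε ω + (1 + t₁)) +
      (ENNReal.ofReal (2 * B * C / r) + 2 + ENNReal.ofReal (2 * B / (q * r) * L)) := by
    intro ω
    by_cases htop : deviationTime alg μ R ε ω = ⊤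
    · have hm0 : (m : ℝ≥0∞) ≠ 0 := by rw [hm]; simp
      rw [htop, top_add, ENNReal.mul_top hm0, top_add]
      exact le_top
    set t₀ : ℕ := ⌊(deviationTime alg μ R ε ω).toReal⌋₊ + 1 + t₁ with ht₀
    have ht₀le : (t₀ : ℝ≥0∞) ≤ deviationTime alg μ R ε ω + (1 + t₁) := by
      rw [ht₀]
      push_cast
      rw [add_assoc]
      gcongr
      have h1 := Nat.floor_le (ENNReal.toReal_nonneg (a := deviationTime alg μ R ε ω))
      calc ((⌊(deviationTime alg μ R ε ω).toReal⌋₊ : ℕ) : ℝ≥0∞)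
          = ENNReal.ofReal (⌊(deviationTime alg μ R ε ω).toReal⌋₊ : ℝ) :=
            (ENNReal.ofReal_natCast _).symm
        _ ≤ ENNReal.ofReal (deviationTime alg μ R ε ω).toReal := ENNReal.ofReal_le_ofReal h1
        _ = _ := ENNReal.ofReal_toReal htop
    have hgood : ∀ t, t₀ ≤ t → ω ∉ deviationEvent alg μ R ε t := fun t ht => by
      refine notMem_deviationEvent ?_
      rw [← ENNReal.ofReal_toReal htop, ← ENNReal.ofReal_natCast,
        ENNReal.ofReal_lt_ofReal_iff_of_nonneg ENNReal.toReal_nonneg]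
      refine (Nat.lt_floor_add_one _).trans_le ?_
      exact_mod_cast (by omega : ⌊(deviationTime alg μ R ε ω).toReal⌋₊ + 1 ≤ t)
    -- The solution of `(1 - q) t + C + L / q = t / (2B)`; beyond it the threshold lies below the
    -- lower bound for the statistic.
    set y := 2 * B * (C + L / q) / r with hy
    have hy0 : 0 ≤ y := by positivity
    set t : ℕ := m * t₀ + (⌈y⌉₊ + 1) with ht
    have htt₀ : t₀ ≤ t := by
      have : 1 * t₀ ≤ m * t₀ := Nat.mul_le_mul_right _ (by omega)
      omega
    obtain ⟨hI, hbt, hcomp⟩ := hpath R ω t₀ (by omega) hgood t htt₀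
    have htpos : (0 : ℝ) < t := by
      have : 0 < t := by omega
      exact_mod_cast this
    have htK : t₀ * K ≤ t * (1 - q) := by
      have h1 : K / (1 - q) ≤ m := by
        rw [hm]; push_cast
        linarith [Nat.le_ceil (K / (1 - q))]
      have h2 : (m : ℝ) * t₀ ≤ t := by
        exact_mod_cast (by omega : m * t₀ ≤ t)
      rw [div_le_iff₀ hq1] at h1
      calc t₀ * K ≤ t₀ * (m * (1 - q)) := by gcongr
        _ = (m * t₀) * (1 - q) := by ring
        _ ≤ t * (1 - q) := by gcongr
    have hv : complexity A (empMean (history R t ω)) b (contextFreq (history R t ω)) ≤ B := by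
      rw [hB, le_div_iff₀ (by positivity), mul_comm]
      refine le_of_mul_le_mul_left ?_ htpos
      linarith
    have hglr := le_glr (x := t / (2 * B)) hI hbt (by exact_mod_cast htpos) (by
      rw [div_mul_eq_mul_div, div_le_iff₀ (by positivity)]
      gcongr)
    have hthr : threshold (history R t ω) δ < t / (2 * B) := by
      refine (hC t _ δ hI (by exact_mod_cast htpos) hδ).trans_lt ?_
      rw [lt_div_iff₀ (by positivity)]
      have h1 : y < t := by
        have h2 := Nat.le_ceil y
        have h3 : (⌈y⌉₊ : ℝ) + 1 ≤ t := by exact_mod_cast (by omega : ⌈y⌉₊ + 1 ≤ t)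
        linarith
      rw [hy, div_lt_iff₀ hr0, hr] at h1
      linarith
    have hle : stoppingTime A R δ ω ≤ (t : ℕ∞) :=
      iInf₂_le t ⟨hI, (EReal.coe_lt_coe_iff.2 hthr).trans_le hglr⟩
    have hyE : ((⌈y⌉₊ : ℕ) : ℝ≥0∞) + 1 ≤
        ENNReal.ofReal (2 * B * C / r) + 2 + ENNReal.ofReal (2 * B / (q * r) * L) := by
      calc ((⌈y⌉₊ : ℕ) : ℝ≥0∞) + 1 = ENNReal.ofReal (⌈y⌉₊ : ℝ) + 1 := by
            rw [ENNReal.ofReal_natCast]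
        _ ≤ ENNReal.ofReal (y + 1) + 1 := by
            gcongr; exact (Nat.ceil_lt_add_one hy0).le
        _ = ENNReal.ofReal (2 * B * C / r + 2 * B / (q * r) * L) + 2 := by
            rw [ENNReal.ofReal_add hy0 zero_le_one, ENNReal.ofReal_one, add_assoc, one_add_one_eq_two]
            congr 2
            rw [hy]; field_simp
        _ = _ := by
            rw [ENNReal.ofReal_add (by positivity) (by positivity)]
            ring
    calc (stoppingTime A R δ ω : ℝ≥0∞) ≤ ((t : ℕ∞) : ℝ≥0∞) := by exact_mod_cast hle
      _ = m * t₀ + (⌈y⌉₊ + 1) := by rw [ht]; push_cast; rfl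
      _ ≤ _ := by gcongr
  refine (lintegral_mono hpt).trans (le_of_eq ?_)
  rw [lintegral_add_right _ measurable_const, lintegral_const, measure_univ, mul_one,
    lintegral_const_mul' _ _ (ENNReal.natCast_ne_top m), lintegral_add_right _ measurable_const,
    lintegral_const, measure_univ, mul_one]
  ring

/-! ### The limits `δ → 0` and `q → 1`. -/

lemma limsup_le_of_affine {f : ℝ → ℝ≥0∞} {E : ℝ≥0∞} (hE : E ≠ ⊤) {x : ℝ} (hx : 0 ≤ x)
    (h : ∀ δ : ℝ, 0 ≤ Real.log (1 / δ) → f δ ≤ E + ENNReal.ofReal (x * Real.log (1 / δ))) :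
    limsup (fun δ : ℝ => f δ / ENNReal.ofReal (Real.log (1 / δ))) (𝓝[>] 0) ≤
      ENNReal.ofReal x := by
  have hlog : Tendsto (fun δ : ℝ => Real.log (1 / δ)) (𝓝[>] 0) atTop := by
    simp_rw [one_div]
    exact Real.tendsto_log_atTop.comp tendsto_inv_nhdsGT_zero
  have hE0 : Tendsto (fun δ : ℝ => E / ENNReal.ofReal (Real.log (1 / δ)) + ENNReal.ofReal x)
      (𝓝[>] 0) (𝓝 (ENNReal.ofReal x)) := by
    have h1 := ENNReal.Tendsto.const_div (ENNReal.tendsto_ofReal_nhds_top.2 hlog)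
      (Or.inr hE)
    rw [ENNReal.div_top] at h1
    simpa using h1.add_const (ENNReal.ofReal x)
  rw [← hE0.limsup_eq]
  refine limsup_le_limsup ?_
  filter_upwards [hlog.eventually_gt_atTop 0] with δ hδ
  have hpos := ENNReal.ofReal_pos.2 hδ
  calc f δ / ENNReal.ofReal (Real.log (1 / δ))
      ≤ (E + ENNReal.ofReal (x * Real.log (1 / δ))) / ENNReal.ofReal (Real.log (1 / δ)) := by
        gcongr; exact h δ hδ.le
    _ = _ := by
        rw [ENNReal.add_div, ENNReal.ofReal_mul hx,
          ENNReal.mul_div_cancel_right hpos.ne' ENNReal.ofReal_ne_top]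

/-- The asymptotic expected stopping time is at most twice the complexity of any point of the
policy space. -/
theorem limsup_stoppingTime_le [IsProbabilityMeasure P] (hA : IsContextMatrix A)
    (hb : IsBestArm A μ b) (hR : IsInteraction P alg μ R) {w₀ : Fin k → ℝ}
    (hw₀ : w₀ ∈ policySpace A) :
    limsup (fun δ : ℝ =>
        (∫⁻ ω, (stoppingTime A R δ ω : ℝ≥0∞) ∂P) / ENNReal.ofReal (Real.log (1 / δ))) (𝓝[>] 0) ≤
      ENNReal.ofReal (2 * complexity A μ b w₀) := by
  have hC₀ : 0 ≤ complexity A μ b w₀ := complexity_nonneg _ _ _ _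
  set B : ℝ → ℝ := fun q => (complexity A μ b w₀ / q ^ 3 + (1 - q)) / q ^ 2 with hB
  have hBc : ContinuousAt B 1 := by
    simp only [hB]
    fun_prop (disch := norm_num)
  have hB1 : B 1 = complexity A μ b w₀ := by simp [hB]
  have hrc : ContinuousAt (fun q => 2 * B q * (1 - q)) 1 := by fun_prop
  have hxc : ContinuousAt (fun q => 2 * B q / (q * (1 - 2 * B q * (1 - q)))) 1 := by
    fun_prop (disch := norm_num)
  have hlim : Tendsto (fun q => ENNReal.ofReal (2 * B q / (q * (1 - 2 * B q * (1 - q)))))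
      (𝓝[<] 1) (𝓝 (ENNReal.ofReal (2 * complexity A μ b w₀))) := by
    refine (ENNReal.tendsto_ofReal ?_).mono_left nhdsWithin_le_nhds
    simpa [ContinuousAt, hB1] using hxc
  -- The limsup does not depend on `q`, so the bounds for `q` close to `1` pass to the limit.
  refine ge_of_tendsto hlim ?_
  have hsmall : ∀ᶠ q in 𝓝[<] (1 : ℝ), 2 * B q * (1 - q) < 1 :=
    nhdsWithin_le_nhds (hrc.eventually_lt_const (by simp))
  filter_upwards [hsmall, Ioo_mem_nhdsLT (show (1 / 2 : ℝ) < 1 by norm_num)] with q h1 hq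
  obtain ⟨E, hE, hle⟩ := exists_lintegral_stoppingTime_le hA hb hR hw₀ hq rfl h1
  have hq0 : 0 < q := lt_trans (by norm_num) hq.1
  have hq1 : 0 < 1 - q := sub_pos.2 hq.2
  have hr : 0 < 1 - 2 * B q * (1 - q) := by linarith
  have hB0 : 0 < B q := by simp only [hB]; positivity
  exact limsup_le_of_affine hE (by positivity) hle

end SeparatorBandit

theorem mainTheorem4 {n k : ℕ} (A : Matrix (Fin k) (Fin n) ℝ)
    (hA : SeparatorBandit.IsContextMatrix A) (alg : SeparatorBandit.SamplingRule A)
    (μ : Fin k → ℝ) (hμ : μ ∈ SeparatorBandit.uniqueBest A)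
    {Ω : Type*} [MeasurableSpace Ω] (P : Measure Ω) [IsProbabilityMeasure P]
    (R : ℕ → Ω → SeparatorBandit.Round n k)
    (hR : SeparatorBandit.IsInteraction P alg μ R) :
    limsup (fun δ : ℝ =>
        (∫⁻ ω, (SeparatorBandit.stoppingTime A R δ ω : ℝ≥0∞) ∂P) /
          ENNReal.ofReal (Real.log (1 / δ))) (𝓝[>] 0)
      ≤ SeparatorBandit.charTime A μ := by
  obtain ⟨b, hb⟩ := hμ
  -- The inverse of the supremum is an infimum of inverses, so it suffices to compare with each `w`;
  -- no optimal `w` is needed.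
  rw [SeparatorBandit.charTime, ENNReal.inv_iSup]
  simp_rw [ENNReal.inv_iSup]
  refine le_iInf₂ fun w hw => ?_
  have hmem := SeparatorBandit.mulVec_mem_policySpace A hw
  obtain ⟨a, ha, hbd⟩ := hA.exists_bounds
  rw [SeparatorBandit.inv_objective hb fun j =>
    ha.trans_le (SeparatorBandit.bounds_of_mem_policySpace hbd hmem j).1]
  exact SeparatorBandit.limsup_stoppingTime_le hA hb hR hmem
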